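/- All graphs are finite and simple. The chromatic Ramsey number $R_{\chi}(G)$ of a graph $G$ is the smallest integer $N$ such that there exists a graph $F$ with chromatic number $\chi(F)=N$ for which every coloring of the edges of $F$ with two colors contains a monochromatic copy of $G$ (as a not necessarily induced subgraph). Let $\Gamma=\Gamma(\mathbb{Z}_8,\{1,2\})$ be the Cayley graph with vertex set $\mathbb{Z}_8$ and edge set $\{\{v,v+s\}: v\in\mathbb{Z}_8,\ s\in\{1,2\}\}$. Let $M$ be the Moser spindle, i.e. the graph on vertices $0,1,\dots,6$ whose edges are $01,02,12,13,23$ (a rhombus made of two triangles), $04,05,45,46,56$ (a second such rhombus sharing the vertex $0$), and $36$. Then $$R_{\chi}(\Gamma)=14\quad\text{and}\quad R_{\chi}(M)=11.$$ -/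

import Mathlib

/-- `ArrowsMono F G`: every colouring of the edges of `F` with two colours has a monochromatic
copy of `G`, that is, one of the two colour classes contains `G` as a (not necessarily induced)
subgraph. -/
def ArrowsMono {V W : Type*} (F : SimpleGraph V) (G : SimpleGraph W) : Prop :=
  ∀ c : F.EdgeLabeling (Fin 2), ∃ i : Fin 2, G.IsContained (c.labelGraph i)

/-- The chromatic Ramsey number of `G`: the smallest integer `N` such that some finite graph `F`
of chromatic number exactly `N` has a monochromatic copy of `G` in every 2-colouring of its edges.
(Were there no such `N`, the value would be the junk value `0`.) -/
noncomputable def chromaticRamseyNumber {W : Type*} (G : SimpleGraph W) : ℕ :=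
  sInf {N : ℕ | ∃ (V : Type) (_ : Finite V) (F : SimpleGraph V),
    F.chromaticNumber = (N : ℕ∞) ∧ ArrowsMono F G}

/-- The Cayley graph of the additive group `ℤ/8ℤ` with connection set `{1, 2}`: its edges are the
pairs `{v, v + s}` with `v ∈ ℤ/8ℤ` and `s ∈ {1, 2}`. -/
def cayleyZ8 : SimpleGraph (ZMod 8) := SimpleGraph.addCayley ({1, 2} : Set (ZMod 8))

/-- The Moser spindle: two rhombi `0, 1, 2, 3` and `0, 4, 5, 6`, each made of two triangles
(`012`, `123` and `045`, `456`), which share the acute vertex `0` and whose opposite acute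
vertices `3` and `6` are joined by an edge. It has 7 vertices and 11 edges. -/
def moserSpindle : SimpleGraph (Fin 7) :=
  SimpleGraph.fromEdgeSet
    {s(0, 1), s(0, 2), s(1, 2), s(1, 3), s(2, 3),
     s(0, 4), s(0, 5), s(4, 5), s(4, 6), s(5, 6),
     s(3, 6)}

/-!
Both values come from the same reduction (Burr, Erdős and Lovász): the chromatic Ramsey number of
`G` is the least `N` such that every 2-colouring of the complete graph on `N` vertices has a colour
class that receives a homomorphism from `G` (`chromaticRamseyNumber_eq`). A colouring of `K_N`
without such homomorphisms pulls back to every `N`-colourable graph. Conversely, in a complete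
`N`-partite graph whose parts grow fast enough, the pigeonhole principle finds large subsets of the
parts between which the colour of an edge depends only on the parts, and homomorphisms into the
quotient lift to injective ones.

Write a colouring as a graph `G` and its complement. The Moser spindle and the square of the 8-cycle
are 4-colourable, so it can be assumed that neither `G` nor `Gᶜ` contains a `K₄`. Then the
neighbourhood of a vertex is triangle-free and without independent 4-sets, and there are few such
graphs on seven vertices: a shortest odd cycle has length 5 or 7, and up to isomorphism the graph is
one of the `patterns` (`exists_pattern`).

*The Moser spindle.* Each pattern contains a spindle in its complement, so all degrees in both
colours are at most 6, and degree 6 is excluded by joining rhombi (`degree_le_five`). On 11 vertices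
both colour classes would be 5-regular, against the parity of the degree sum. On ten vertices the
circulant graph with jumps 1 and 2 is a colouring without monochromatic images.

*The square of the 8-cycle.* Adding a vertex to a pattern without creating a triangle or an
independent 4-set yields the square of an 8-cycle in the complement
(`nonempty_cayleyZ8_hom_compl`). So every 8-set contains a triangle and an
independent triple, degrees are at most 7, and on 14 vertices some vertex has degree 7 in one of the
colours, while all other degrees are 6 or 7. The seven neighbours of that vertex, the apex, induce a
pattern. The other six vertices are described by their neighbours in the pattern, their cones, and
contain a triangle. The conditions on cones, degrees, 4-cliques and 8-sets leave no solution, which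
a finite search verifies (`search_patterns`): the three vertices outside the triangle are pairwise
adjacent by `IsApex.adj_of_searchNonadjacent`, and do not form a triangle by
`IsApex.not_pairwise_of_searchTriangles`. On 13 vertices the circulant graph with jumps 1, 3 and 4
is a colouring without monochromatic images.

The searches run by reduction in the kernel. For that reason sets of small numbers are bit masks,
and the functions on them are bare recursors over arithmetic that the kernel evaluates natively.
-/

namespace ChromaticRamsey

open SimpleGraph

/-! ### Reduction to colourings of complete graphs -/

/-- Part sizes for the blow-up: each part is `2 ^ (total size of the earlier parts)` times `m`. -/
theorem exists_rapid_sequence (m : ℕ) :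
    ∃ t : ℕ → ℕ, ∀ j, 2 ^ (∑ i : Fin j, t i) * m = t j := by
  let T : ℕ → ℕ := fun n ↦ Nat.rec 0 (fun _ s ↦ s + 2 ^ s * m) n
  refine ⟨fun j ↦ 2 ^ T j * m, fun j ↦ ?_⟩
  suffices h : ∑ i : Fin j, 2 ^ T i * m = T j by simp only [h]
  rw [Fin.sum_univ_eq_sum_range (fun i ↦ 2 ^ T i * m) j]
  induction j with
  | zero => simp [T]
  | succ k ih => rw [Finset.sum_range_succ, ih]

/-- If every 2-colouring of the complete graph on `Fin N` admits a homomorphism from `G` into one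
of its colour classes, then a complete `N`-partite graph with suitable parts arrows `G`.
Shrinking the parts twice by the pigeonhole principle makes the colour of an edge depend only on
the two parts it joins; a homomorphism into the coloured graph of parts then lifts to a copy. -/
theorem exists_multipartite_arrowsMono {W : Type*} [Finite W] (G : SimpleGraph W) (N : ℕ)
    (h : ∀ R : SimpleGraph (Fin N), Nonempty (G →g R) ∨ Nonempty (G →g Rᶜ)) :
    ∃ t : Fin N → ℕ, (∀ i, 0 < t i) ∧
      ArrowsMono (completeMultipartiteGraph fun i ↦ Fin (t i)) G := by
  classical
  have := Fintype.ofFinite W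
  set w := Fintype.card W + 1
  set m := 2 ^ N * w
  obtain ⟨t, ht⟩ := exists_rapid_sequence m
  have hm0 : 0 < m := by positivity
  refine ⟨fun i ↦ t i, fun i ↦
    (by positivity : 0 < 2 ^ (∑ l : Fin (i : ℕ), t l) * m).trans_eq (ht i), ?_⟩
  set F := completeMultipartiteGraph fun i : Fin N ↦ Fin (t i)
  intro c
  let col : (Σ i : Fin N, Fin (t i)) → (Σ i : Fin N, Fin (t i)) → Fin 2 :=
    fun x y ↦ if hxy : F.Adj x y then c.get x y hxy else 0
  -- the colour of an edge into the `j`-th part does not depend on its end in `Y j`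
  have step1 : ∀ j : Fin N, ∃ Y : Finset (Fin (t j)), m ≤ Y.card ∧
      ∀ y ∈ Y, ∀ y' ∈ Y, ∀ x : Σ i : Fin N, Fin (t i), x.1 < j → col x ⟨j, y⟩ = col x ⟨j, y'⟩ := by
    intro j
    let f : Fin (t j) → ((Σ i : Fin (j : ℕ), Fin (t i)) → Fin 2) :=
      fun y x ↦ col ⟨⟨x.1, x.1.2.trans j.2⟩, x.2⟩ ⟨j, y⟩
    obtain ⟨b, hb⟩ := Fintype.exists_le_card_fiber_of_mul_le_card (f := f) (n := m) (by
      simp only [Fintype.card_fun, Fintype.card_fin, Fintype.card_sigma]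
      exact (ht j).le)
    refine ⟨_, hb, fun y hy y' hy' x hx ↦ ?_⟩
    have h1 : f y = f y' := by simp_all
    exact congrFun h1 ⟨⟨x.1, hx⟩, x.2⟩
  choose Y hY hYc using step1
  have hne : ∀ j, (Y j).Nonempty := fun j ↦ Finset.card_pos.1 (hm0.trans_le (hY j))
  choose r hr using hne
  -- the colour of an edge out of the `i`-th part does not depend on its end in `Z i` either
  have step2 : ∀ i : Fin N, ∃ Z ⊆ Y i, w ≤ Z.card ∧
      ∀ x ∈ Z, ∀ x' ∈ Z, ∀ j : Fin N, col ⟨i, x⟩ ⟨j, r j⟩ = col ⟨i, x'⟩ ⟨j, r j⟩ := by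
    intro i
    let f : Fin (t i) → (Fin N → Fin 2) := fun x j ↦ col ⟨i, x⟩ ⟨j, r j⟩
    obtain ⟨b, -, hb⟩ := Finset.exists_le_card_fiber_of_mul_le_card_of_maps_to (s := Y i)
      (t := Finset.univ) (f := f) (n := w) (fun _ _ ↦ Finset.mem_univ _) Finset.univ_nonempty (by
        simpa [Finset.card_univ] using hY i)
    refine ⟨_, Finset.filter_subset _ _, hb, fun x hx x' hx' j ↦ ?_⟩
    have h1 : f x = f x' := by simp_all
    exact congrFun h1 j
  choose Z hZY hZ hZc using step2
  have hne : ∀ j, (Z j).Nonempty := fun j ↦ Finset.card_pos.1 (by have := hZ j; omega)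
  choose z hz using hne
  have key : ∀ i j : Fin N, i < j → ∀ x ∈ Z i, ∀ y ∈ Z j,
      col ⟨i, x⟩ ⟨j, y⟩ = col ⟨i, z i⟩ ⟨j, r j⟩ := fun i j hij x hx y hy ↦ by
    rw [hYc j y (hZY j hy) (r j) (hr j) ⟨i, x⟩ hij, hZc i x hx (z i) (hz i) j]
  have hsymm : ∀ x y, col x y = col y x := fun x y ↦ by
    by_cases hxy : F.Adj x y
    · simp only [col, hxy, hxy.symm, dif_pos]
      exact EdgeLabeling.get_comm _ _ _
    · have hyx : ¬ F.Adj y x := fun h ↦ hxy h.symm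
      simp only [col, hxy, hyx, dif_neg, not_false_eq_true]
  have emb : ∀ i, Nonempty (W ↪ Z i) := fun i ↦ Function.Embedding.nonempty_of_card_le (by
    rw [Fintype.card_coe]; have := hZ i; omega)
  have lift : ∀ (R : SimpleGraph (Fin N)) (k : Fin 2)
      (_ : ∀ i j, i < j → R.Adj i j → col ⟨i, z i⟩ ⟨j, r j⟩ = k),
      Nonempty (G →g R) → G.IsContained (c.labelGraph k) := by
    rintro R k hR ⟨φ⟩
    let ψ : W → Σ i : Fin N, Fin (t i) := fun u ↦ ⟨φ u, ((emb (φ u)).some u).1⟩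
    have hψ : ∀ u v, G.Adj u v → (c.labelGraph k).Adj (ψ u) (ψ v) := by
      intro u v huv
      have hφ := φ.map_adj huv
      have hFa : F.Adj (ψ u) (ψ v) := hφ.ne
      have hcol : col (ψ u) (ψ v) = k := by
        rcases lt_or_gt_of_ne hφ.ne with hlt | hlt
        · exact (key _ _ hlt _ ((emb (φ u)).some u).2 _ ((emb (φ v)).some v).2).trans
            (hR _ _ hlt hφ)
        · rw [hsymm]
          exact (key _ _ hlt _ ((emb (φ v)).some v).2 _ ((emb (φ u)).some u).2).trans
            (hR _ _ hlt hφ.symm)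
      rw [EdgeLabeling.labelGraph_adj]
      refine ⟨hFa, ?_⟩
      simp only [col, hFa, dif_pos] at hcol
      exact hcol
    refine ⟨⟨⟨ψ, fun {u v} ↦ hψ u v⟩, fun u v huv ↦ ?_⟩⟩
    have h1 : φ u = φ v := congrArg Sigma.fst huv
    have h2 : HEq ((emb (φ u)).some u).1 ((emb (φ v)).some v).1 := (Sigma.mk.inj huv).2
    rw [← h1] at h2
    exact (emb (φ u)).some.injective (Subtype.ext (eq_of_heq h2))
  let R : SimpleGraph (Fin N) := SimpleGraph.fromRel fun i j ↦ i < j ∧ col ⟨i, z i⟩ ⟨j, r j⟩ = 0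
  have hR : ∀ i j, i < j → (R.Adj i j ↔ col ⟨i, z i⟩ ⟨j, r j⟩ = 0) := fun i j hij ↦ by
    simp [R, hij, hij.ne, hij.not_gt]
  rcases h R with h0 | h1
  · exact ⟨0, lift R 0 (fun i j hij hh ↦ (hR i j hij).1 hh) h0⟩
  · refine ⟨1, lift Rᶜ 1 (fun i j hij hh ↦ ?_) h1⟩
    have : ¬ R.Adj i j := ((compl_adj _ _ _).1 hh).2
    rw [hR i j hij] at this
    omega

/-- A colouring of the complete graph on `k` vertices without homomorphisms from `G` into a colour
class pulls back to every `k`-colourable graph. -/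
theorem not_arrowsMono_of_colorable {W V : Type*} {G : SimpleGraph W} {k : ℕ}
    (R : SimpleGraph (Fin k)) (hR : IsEmpty (G →g R)) (hRc : IsEmpty (G →g Rᶜ))
    (F : SimpleGraph V) (hF : F.Colorable k) : ¬ ArrowsMono F G := by
  classical
  obtain ⟨C⟩ := hF
  intro h
  let c : F.EdgeLabeling (Fin 2) :=
    EdgeLabeling.mk (fun x y _ ↦ if R.Adj (C x) (C y) then 0 else 1)
      (fun x y _ ↦ by simp only [R.adj_comm])
  obtain ⟨i, ⟨f⟩⟩ := h c
  have hf : ∀ u v, G.Adj u v → ∃ H : F.Adj (f u) (f v),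
      (if R.Adj (C (f u)) (C (f v)) then (0 : Fin 2) else 1) = i := fun u v huv ↦
    (EdgeLabeling.labelGraph_adj _ _).1 (f.toHom.map_adj huv)
  fin_cases i
  · refine hR.false ⟨fun u ↦ C (f u), fun {u v} huv ↦ ?_⟩
    obtain ⟨H, h1⟩ := hf u v huv
    by_contra h2
    simp [h2] at h1
  · refine hRc.false ⟨fun u ↦ C (f u), fun {u v} huv ↦ ?_⟩
    obtain ⟨H, h1⟩ := hf u v huv
    refine (compl_adj _ _ _).2 ⟨C.valid H, fun h2 ↦ ?_⟩
    simp [h2] at h1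

/-- The chromatic Ramsey number is the Ramsey number of the family of homomorphic images
(Burr, Erdős and Lovász). -/
theorem chromaticRamseyNumber_eq {W : Type*} [Finite W] (G : SimpleGraph W) (k : ℕ)
    (upper : ∀ R : SimpleGraph (Fin (k + 1)), Nonempty (G →g R) ∨ Nonempty (G →g Rᶜ))
    (R : SimpleGraph (Fin k)) (hR : IsEmpty (G →g R)) (hRc : IsEmpty (G →g Rᶜ)) :
    chromaticRamseyNumber G = k + 1 := by
  obtain ⟨t, ht, harrow⟩ := exists_multipartite_arrowsMono G (k + 1) upper
  refine le_antisymm (Nat.sInf_le ⟨_, inferInstance, _, ?_, harrow⟩) (le_csInf ?_ ?_)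
  · rw [completeMultipartiteGraph.chromaticNumber _ fun i ↦ ⟨0, ht i⟩, Fintype.card_fin]
  · refine ⟨k + 1, _, inferInstance, _, ?_, harrow⟩
    rw [completeMultipartiteGraph.chromaticNumber _ fun i ↦ ⟨0, ht i⟩, Fintype.card_fin]
  · rintro n ⟨V, _, F, hχ, hF⟩
    by_contra! hn
    refine not_arrowsMono_of_colorable R hR hRc F ?_ hF
    exact chromaticNumber_le_iff_colorable.1 (hχ.trans_le (by exact_mod_cast Nat.le_of_lt_succ hn))

/-! ### Sets of small numbers as bit masks -/

noncomputable section Masks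

/-- Conjunction as a bare recursor: the kernel evaluates it in one step and lazily. -/
def conj (a b : Bool) : Bool := Bool.rec false b a

/-- Implication as a bare recursor, lazy in its second argument. -/
def imp (a b : Bool) : Bool := Bool.rec true b a

/-- Negation as a bare recursor. -/
def neg (a : Bool) : Bool := Bool.rec true false a

/-- The `i`-th binary digit of `X`, written with operations on literals that the kernel
evaluates natively. -/
def bit (X i : ℕ) : Bool := Nat.beq (Nat.land (Nat.shiftRight X i) 1) 1

/-- Whether `f` holds at all entries of `l`. -/
def lall (f : ℕ → Bool) (l : List ℕ) : Bool := List.rec true (fun a _ ih ↦ conj (f a) ih) l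

/-- Whether `f` holds at all entries of `l` that lie in the set `X`. -/
def lallIn (X : ℕ) (f : ℕ → Bool) (l : List ℕ) : Bool :=
  Bool.rec (List.rec true (fun a _ ih ↦ Bool.rec ih (conj (f a) ih) (bit X a)) l) true
    (Nat.beq X 0)

/-- The sublist of the entries of `l` that satisfy `f`. -/
def lfilter (f : ℕ → Bool) (l : List ℕ) : List ℕ :=
  List.rec [] (fun a _ ih ↦ Bool.rec ih (a :: ih) (f a)) l

/-- The set of the entries of `l` that satisfy `f`, as a bit mask. -/
def setOf (f : ℕ → Bool) (l : List ℕ) : ℕ :=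
  List.rec 0 (fun a _ ih ↦ Bool.rec ih (Nat.lor ih (Nat.pow 2 a)) (f a)) l

/-- The numbers below `n`. -/
def upto (n : ℕ) : List ℕ := Nat.rec (fun l ↦ l) (fun n ih l ↦ ih (n :: l)) n []

/-- Entry `i` of a list of masks, for instance of the rows of an adjacency matrix. -/
def get (L : List ℕ) (i : ℕ) : ℕ :=
  List.rec (fun _ ↦ 0) (fun a _ ih i ↦ Nat.rec a (fun n _ ↦ ih n) i) L i

/-- Whether the set `X` is contained in the set `Y`. -/
def subset (X Y : ℕ) : Bool := Nat.beq (Nat.land X Y) X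

/-- Whether the sets `X` and `Y` are disjoint. -/
def disj (X Y : ℕ) : Bool := Nat.beq (Nat.land X Y) 0

/-- Indices of a set of seven vertices. -/
def I7 : List ℕ := [0, 1, 2, 3, 4, 5, 6]

/-- Indices of a set of six vertices. -/
def I6 : List ℕ := [0, 1, 2, 3, 4, 5]

/-- The number of elements below 7 of the set `X`. -/
def card (X : ℕ) : ℕ :=
  List.rec 0 (fun a _ ih ↦ Nat.add ih (Nat.land (Nat.shiftRight X a) 1)) I7

/-- The complement in `{0, …, 6}`. -/
def compl (X : ℕ) : ℕ := Nat.xor 127 X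

/-- The intersection of the sets `f i` over `i ∈ X`, within `{0, …, 127}`. -/
def foldIn (f : ℕ → ℕ) (X : ℕ) : ℕ :=
  List.rec (Nat.sub (Nat.pow 2 128) 1) (fun i _ ih ↦ Bool.rec ih (Nat.land (f i) ih) (bit X i)) I6

/-- Whether `X` is independent in the graph on `I` with adjacency rows `R`. -/
def indep (I R : List ℕ) (X : ℕ) : Bool :=
  lall (fun i ↦ imp (bit X i) (disj (get R i) X)) I

/-- Whether `X` is a clique of the graph on `I` with adjacency rows `R`. -/
def clique (I R : List ℕ) (X : ℕ) : Bool :=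
  lall (fun i ↦ imp (bit X i) (subset X (Nat.lor (get R i) (Nat.pow 2 i)))) I

/-- Whether `X` contains no triangle: the neighbours in `X` of each vertex of `X` are
independent. -/
def triFree (I R : List ℕ) (X : ℕ) : Bool :=
  lall (fun i ↦ imp (bit X i) (indep I R (Nat.land X (get R i)))) I

/-- Whether `X` contains no independent triple, for subsets `X` of `{0, …, 6}`: the non-neighbours
in `X` of each vertex of `X` form a clique. -/
def antiFree (R : List ℕ) (X : ℕ) : Bool :=
  lall (fun i ↦ imp (bit X i)
    (clique I7 R (Nat.land X (compl (Nat.lor (get R i) (Nat.pow 2 i)))))) I7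

/-- The `k`-element subsets of `{0, …, 6}` among the masks below `n`. -/
def subsets (n k : ℕ) : List ℕ := lfilter (fun X ↦ Nat.beq (card X) k) (upto n)

end Masks

theorem conj_iff {a b : Bool} : conj a b = true ↔ a = true ∧ b = true := by
  cases a <;> simp [conj]

theorem imp_iff {a b : Bool} : imp a b = true ↔ (a = true → b = true) := by
  cases a <;> simp [imp]

theorem neg_iff {a : Bool} : neg a = true ↔ ¬ a = true := by cases a <;> simp [neg]

theorem beq_iff {a b : ℕ} : Nat.beq a b = true ↔ a = b := Nat.beq_eq ▸ Iff.rfl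

theorem ble_iff {a b : ℕ} : Nat.ble a b = true ↔ a ≤ b := by rw [Nat.ble_eq]

theorem bit_eq (X i : ℕ) : bit X i = X.testBit i := by
  have h1 : Nat.land (Nat.shiftRight X i) 1 = 1 &&& (X >>> i) := Nat.land_comm _ _
  have h2 : 1 &&& (X >>> i) = 0 ∨ 1 &&& (X >>> i) = 1 := by
    rw [Nat.one_and_eq_mod_two]; omega
  rw [bit, h1, Nat.testBit]
  rcases h2 with h | h <;> rw [h] <;> rfl

theorem bit_and_one (X i : ℕ) :
    Nat.land (Nat.shiftRight X i) 1 = if bit X i = true then 1 else 0 := by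
  have h1 : Nat.land (Nat.shiftRight X i) 1 = (X >>> i) % 2 := Nat.and_one_is_mod _
  rw [bit_eq, h1, Nat.testBit, Nat.one_and_eq_mod_two]
  rcases Nat.mod_two_eq_zero_or_one (X >>> i) with h | h <;> simp [h]

theorem bit_land (X Y i : ℕ) : bit (Nat.land X Y) i = (bit X i && bit Y i) := by
  simp only [bit_eq]; exact Nat.testBit_land X Y i

theorem bit_lor (X Y i : ℕ) : bit (Nat.lor X Y) i = (bit X i || bit Y i) := by
  simp only [bit_eq]; exact Nat.testBit_lor X Y i

theorem bit_pow (a i : ℕ) : bit (Nat.pow 2 a) i = decide (a = i) := by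
  rw [bit_eq]; exact Nat.testBit_two_pow

theorem bit_zero (i : ℕ) : bit 0 i = false := by rw [bit_eq]; exact Nat.zero_testBit i

theorem bit_compl (X : ℕ) {i : ℕ} (hi : i < 7) : bit (compl X) i = !bit X i := by
  simp only [bit_eq, compl]
  have h : Nat.testBit 127 i = true := by interval_cases i <;> rfl
  exact (Nat.testBit_xor 127 X i).trans (by rw [h]; simp)

theorem lt_of_bit {X n i : ℕ} (hX : X < 2 ^ n) (h : bit X i = true) : i < n := by
  rw [bit_eq] at h
  by_contra! hn
  rw [Nat.testBit_lt_two_pow (hX.trans_le (Nat.pow_le_pow_right (by norm_num) hn))] at h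
  simp at h

theorem compl_lt {X : ℕ} (hX : X < 128) : compl X < 128 :=
  Nat.xor_lt_two_pow (n := 7) (by norm_num) hX

theorem land_lt {X Y n : ℕ} (hX : X < n) : Nat.land X Y < n :=
  (Nat.and_le_left : X &&& Y ≤ X).trans_lt hX

theorem lor_lt {X Y : ℕ} (hX : X < 128) (hY : Y < 128) : Nat.lor X Y < 128 :=
  Nat.or_lt_two_pow (n := 7) hX hY

theorem lall_iff {f : ℕ → Bool} {l : List ℕ} : lall f l = true ↔ ∀ a ∈ l, f a = true := by
  induction l with
  | nil => simp [lall]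
  | cons a l ih =>
    have : lall f (a :: l) = conj (f a) (lall f l) := rfl
    rw [this, conj_iff, ih]; simp

theorem lallIn_iff {X : ℕ} {f : ℕ → Bool} {l : List ℕ} :
    lallIn X f l = true ↔ ∀ a ∈ l, bit X a = true → f a = true := by
  have key : (List.rec true (fun a _ ih ↦ Bool.rec ih (conj (f a) ih) (bit X a)) l : Bool) = true ↔
      ∀ a ∈ l, bit X a = true → f a = true := by
    induction l with
    | nil => simp
    | cons a l ih =>
      cases h : bit X a <;> simp [h, ih, conj_iff]
  rw [lallIn]
  cases h : Nat.beq X 0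
  · exact key
  · rw [beq_iff] at h
    subst h
    simp [bit_zero]

theorem mem_lfilter {f : ℕ → Bool} {l : List ℕ} {a : ℕ} :
    a ∈ lfilter f l ↔ a ∈ l ∧ f a = true := by
  have : lfilter f l = l.filter f := by
    induction l with
    | nil => rfl
    | cons a l ih =>
      have h1 : lfilter f (a :: l) = Bool.rec (lfilter f l) (a :: lfilter f l) (f a) := rfl
      rw [h1, List.filter_cons, ih]
      cases f a <;> rfl
  rw [this, List.mem_filter]

theorem bit_setOf {f : ℕ → Bool} {l : List ℕ} {i : ℕ} :
    bit (setOf f l) i = true ↔ i ∈ l ∧ f i = true := by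
  induction l with
  | nil => simp [setOf, bit_zero]
  | cons a l ih =>
    have h1 : setOf f (a :: l) = Bool.rec (setOf f l) (Nat.lor (setOf f l) (Nat.pow 2 a)) (f a) :=
      rfl
    rw [h1]
    cases h : f a
    · simp only [ih, List.mem_cons]
      constructor
      · exact fun h ↦ ⟨.inr h.1, h.2⟩
      · rintro ⟨rfl | h1, h2⟩
        · simp [h] at h2
        · exact ⟨h1, h2⟩
    · simp only [bit_lor, bit_pow, Bool.or_eq_true, ih, List.mem_cons, decide_eq_true_eq]
      constructor
      · rintro (h1 | rfl)
        · exact ⟨.inr h1.1, h1.2⟩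
        · exact ⟨.inl rfl, h⟩
      · rintro ⟨rfl | h1, h2⟩
        · exact .inr rfl
        · exact .inl ⟨h1, h2⟩

theorem mem_upto {n a : ℕ} : a ∈ upto n ↔ a < n := by
  have key : ∀ n (l : List ℕ), a ∈ (Nat.rec (fun l ↦ l) (fun n ih l ↦ ih (n :: l)) n : List ℕ →
      List ℕ) l ↔ a < n ∨ a ∈ l := by
    intro n
    induction n with
    | zero => simp
    | succ n ih =>
      intro l
      refine (ih (n :: l)).trans ?_
      simp only [List.mem_cons]
      constructor
      · rintro (h | rfl | h)
        · exact .inl (by omega)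
        · exact .inl (by omega)
        · exact .inr h
      · rintro (h | h)
        · by_cases h' : a = n
          · exact .inr (.inl h')
          · exact .inl (by omega)
        · exact .inr (.inr h)
  exact (key n []).trans (by simp)

theorem mem_I7 {i : ℕ} : i ∈ I7 ↔ i < 7 := by
  simp only [I7, List.mem_cons, List.not_mem_nil, or_false]; omega

theorem mem_I6 {i : ℕ} : i ∈ I6 ↔ i < 6 := by
  simp only [I6, List.mem_cons, List.not_mem_nil, or_false]; omega

theorem subset_iff {X Y : ℕ} : subset X Y = true ↔ ∀ i, bit X i = true → bit Y i = true := by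
  rw [subset, beq_iff]
  constructor
  · intro h i hi
    rw [← h, bit_land] at hi
    simp_all
  · intro h
    refine Nat.eq_of_testBit_eq fun i ↦ ?_
    rw [← bit_eq, ← bit_eq, bit_land]
    have := h i
    cases h1 : bit X i <;> simp_all

theorem disj_iff {X Y : ℕ} : disj X Y = true ↔ ∀ i, bit X i = true → ¬ bit Y i = true := by
  rw [disj, beq_iff]
  constructor
  · intro h i hi hj
    have h2 : bit (Nat.land X Y) i = true := by rw [bit_land, hi, hj]; rfl
    rw [h, bit_zero] at h2
    simp at h2
  · intro h
    refine Nat.eq_of_testBit_eq fun i ↦ ?_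
    rw [← bit_eq, ← bit_eq, bit_land, bit_zero]
    have := h i
    cases h1 : bit X i <;> simp_all

theorem card_eq (X : ℕ) : card X = ((Finset.range 7).filter fun i ↦ bit X i = true).card := by
  rw [Finset.card_filter, Finset.sum_range_succ, Finset.sum_range_succ, Finset.sum_range_succ,
    Finset.sum_range_succ, Finset.sum_range_succ, Finset.sum_range_succ, Finset.sum_range_succ,
    Finset.sum_range_zero, ← bit_and_one, ← bit_and_one, ← bit_and_one, ← bit_and_one,
    ← bit_and_one, ← bit_and_one, ← bit_and_one]
  simp only [card, I7, Nat.add_eq]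
  omega

theorem mem_subsets {n k X : ℕ} : X ∈ subsets n k ↔ X < n ∧ card X = k := by
  rw [subsets, mem_lfilter, mem_upto, beq_iff]

theorem bit_foldIn {f : ℕ → ℕ} {X q : ℕ} :
    bit (foldIn f X) q = true ↔ q < 128 ∧ ∀ i < 6, bit X i = true → bit (f i) q = true := by
  have key : ∀ l : List ℕ, bit (List.rec (Nat.sub (Nat.pow 2 128) 1)
      (fun i _ ih ↦ Bool.rec ih (Nat.land (f i) ih) (bit X i)) l : ℕ) q = true ↔
      q < 128 ∧ ∀ i ∈ l, bit X i = true → bit (f i) q = true := by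
    intro l
    induction l with
    | nil =>
      have h : (Nat.sub (Nat.pow 2 128) 1).testBit q = decide (q < 128) :=
        Nat.testBit_two_pow_sub_one 128 q
      rw [bit_eq]
      simp only [h, decide_eq_true_eq, List.not_mem_nil, false_implies, implies_true, and_true]
    | cons a l ih =>
      cases h : bit X a
      · simp only [h, List.mem_cons, forall_eq_or_imp, Bool.false_eq_true, false_implies, true_and]
        exact ih
      · simp only [bit_land, Bool.and_eq_true, ih, List.mem_cons, forall_eq_or_imp, h]
        tauto
  exact (key I6).trans (by simp only [mem_I6])

theorem indep_iff {I R : List ℕ} {X : ℕ} : indep I R X = true ↔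
    ∀ i ∈ I, bit X i = true → ∀ j, bit X j = true → ¬ bit (get R i) j = true := by
  simp only [indep, lall_iff, imp_iff, disj_iff]
  exact forall₂_congr fun i _ ↦ imp_congr_right fun _ ↦ forall_congr' fun j ↦ by tauto

theorem clique_iff {I R : List ℕ} {X : ℕ} : clique I R X = true ↔
    ∀ i ∈ I, bit X i = true → ∀ j, bit X j = true → i ≠ j → bit (get R i) j = true := by
  simp only [clique, lall_iff, imp_iff, subset_iff, bit_lor, bit_pow, Bool.or_eq_true,
    decide_eq_true_eq]
  exact forall₂_congr fun i _ ↦ imp_congr_right fun _ ↦ forall_congr' fun j ↦ by tauto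

theorem triFree_iff {I R : List ℕ} {X : ℕ} : triFree I R X = true ↔
    ∀ i ∈ I, bit X i = true → ∀ j ∈ I, bit X j = true → bit (get R i) j = true →
      ∀ k, bit X k = true → bit (get R i) k = true → ¬ bit (get R j) k = true := by
  simp only [triFree, lall_iff, imp_iff, indep_iff, bit_land, Bool.and_eq_true, and_imp]

theorem antiFree_iff {R : List ℕ} {X : ℕ} (hX : X < 128) : antiFree R X = true ↔
    ∀ i < 7, bit X i = true → ∀ j < 7, bit X j = true → i ≠ j → ¬ bit (get R i) j = true →
      ∀ k < 7, bit X k = true → i ≠ k → ¬ bit (get R i) k = true → j ≠ k →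
        bit (get R j) k = true := by
  have hlt : ∀ i, bit X i = true → i < 7 := fun i ↦ lt_of_bit (n := 7) hX
  simp only [antiFree, lall_iff, imp_iff, clique_iff, bit_land, Bool.and_eq_true, mem_I7]
  refine forall₂_congr fun i _ ↦ imp_congr_right fun _ ↦ ?_
  constructor
  · intro h j hj hXj hij hRj k hk hXk hik hRk hjk
    refine h j hj ⟨hXj, ?_⟩ k ⟨hXk, ?_⟩ hjk
    · rw [bit_compl _ hj, bit_lor, bit_pow]; simp [hij, hRj]
    · rw [bit_compl _ hk, bit_lor, bit_pow]; simp [hik, hRk]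
  · rintro h j hj ⟨hXj, hcj⟩ k ⟨hXk, hck⟩ hjk
    have hk := hlt k hXk
    simp only [bit_compl _ hj, bit_compl _ hk, bit_lor, bit_pow, Bool.not_eq_true',
      Bool.or_eq_false_iff, decide_eq_false_iff_not] at hcj hck
    exact h j hj hXj hcj.2 (by simp [hcj.1]) k hk hXk hck.2 (by simp [hck.1]) hjk

/-! ### Triangle-free graphs on seven vertices with independence number at most three -/

/-- The vertices `f 0, …, f 6` are distinct and induce the graph with adjacency rows `R`. -/
structure IsPattern {V : Type*} (G : SimpleGraph V) (R : List ℕ) (f : ℕ → V) : Prop where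
  inj : ∀ i < 7, ∀ j < 7, f i = f j → i = j
  adj : ∀ i < 7, ∀ j < 7, (G.Adj (f i) (f j) ↔ bit (get R i) j = true)

/-- The set of vertices `f i` with `i < 7` in the mask `X`. -/
noncomputable def maskSet {V : Type*} (f : ℕ → V) (X : ℕ) : Finset V := by
  classical exact ((Finset.range 7).filter fun i ↦ bit X i = true).image f

theorem mem_maskSet {V : Type*} {f : ℕ → V} {X : ℕ} {x : V} :
    x ∈ maskSet f X ↔ ∃ i < 7, bit X i = true ∧ f i = x := by
  classical
  simp only [maskSet, Finset.mem_image, Finset.mem_filter, Finset.mem_range]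
  constructor
  · rintro ⟨i, ⟨h1, h2⟩, h3⟩; exact ⟨i, h1, h2, h3⟩
  · rintro ⟨i, h1, h2, h3⟩; exact ⟨i, ⟨h1, h2⟩, h3⟩

theorem card_maskSet {V : Type*} {f : ℕ → V} {X : ℕ}
    (hf : ∀ i < 7, bit X i = true → ∀ j < 7, bit X j = true → f i = f j → i = j) :
    (maskSet f X).card = card X := by
  classical
  rw [maskSet, Finset.card_image_of_injOn, card_eq]
  intro i hi j hj hij
  simp only [Finset.coe_filter, Finset.mem_range, Set.mem_ofPred_eq] at hi hj
  exact hf i hi.1 hi.2 j hj.1 hj.2 hij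

noncomputable section Patterns

/-- The nine triangle-free graphs on seven vertices without four independent vertices, as
adjacency rows. In all but the last, the vertices `0, …, 4` form a pentagon in this order; the
last one is the heptagon. -/
def patterns : List (List ℕ) :=
  [[18, 5, 10, 20, 9, 64, 32], [82, 5, 10, 20, 9, 64, 33], [82, 5, 74, 20, 9, 64, 37],
   [50, 69, 10, 20, 9, 65, 34], [50, 5, 74, 20, 9, 65, 36], [50, 69, 10, 84, 9, 65, 42],
   [50, 69, 10, 20, 73, 65, 50], [50, 69, 42, 84, 9, 69, 42], [66, 5, 10, 20, 40, 80, 33]]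

/-- Adjacency in a pentagon `0, …, 4` with two further vertices: `5` has neighbours `x` in the
pentagon, `6` has neighbours `y`, and `e` tells whether `5` and `6` are adjacent. -/
def pentAdj (x y : ℕ) (e : Bool) : ℕ → ℕ → Bool
  | 5, 6 => e
  | 6, 5 => e
  | 5, j => bit x j
  | i, 5 => bit x i
  | 6, j => bit y j
  | i, 6 => bit y i
  | i, j => Nat.beq ((i + 1) % 5) j || Nat.beq ((j + 1) % 5) i

/-- Whether `x` is an independent set of the pentagon. -/
def pentIndep (x : ℕ) : Bool :=
  lall (fun i ↦ imp (bit x i) (neg (bit x ((i + 1) % 5)))) [0, 1, 2, 3, 4]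

/-- The adjacency rows of `pentAdj`. -/
def pentRows (x y : ℕ) (e : Bool) : List ℕ := I7.map fun i ↦ setOf (pentAdj x y e i) I7

/-- Whether the graph with rows `R` is triangle-free without four independent vertices. -/
def isRamsey34 (R : List ℕ) : Bool :=
  conj (triFree I7 R 127) (lall (fun X ↦ neg (indep I7 R X)) (subsets 128 4))

/-- Whether `σ` is an injection of `{0, …, 6}` along which `R` pulls back to `Q`. -/
def relabels (R σ Q : List ℕ) : Bool :=
  lall (fun i ↦ conj (Nat.ble (get σ i) 6) (lall (fun j ↦
    conj (imp (Nat.beq (get σ i) (get σ j)) (Nat.beq i j))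
      (conj (imp (bit (get Q i) j) (bit (get R (get σ i)) (get σ j)))
        (imp (bit (get R (get σ i)) (get σ j)) (bit (get Q i) j)))) I7)) I7

/-- The symmetries of a pentagon with two further vertices. -/
def pentSymms : List (List ℕ) :=
  [0, 1, 2, 3, 4].flatMap fun r ↦ [1, 4].flatMap fun s ↦ [5, 6].map fun t ↦
    ([0, 1, 2, 3, 4].map fun i ↦ (s * i + r) % 5) ++ [t, 11 - t]

/-- Besides the identity, two relabellings that move the pentagon to another pentagon of the same
graph. -/
def pentMoves : List (List ℕ) :=
  [[0, 1, 2, 3, 4, 5, 6], [1, 6, 4, 3, 2, 5, 0], [0, 1, 6, 3, 4, 5, 2]]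

/-- Pentagon graphs up to the symmetries of the pentagon: the first eight patterns, and two more
that are isomorphic to two of these. -/
def pentPatterns : List (List ℕ) :=
  patterns.take 8 ++ [[50, 69, 10, 20, 73, 1, 18], [50, 69, 42, 84, 9, 5, 10]]

end Patterns

theorem pentRows_check : (lall (fun x ↦ imp (pentIndep x) (lall (fun y ↦ imp (pentIndep y)
    (lall (fun e ↦ imp (isRamsey34 (pentRows x y (Nat.beq e 1)))
      (pentSymms.any fun σ ↦ pentPatterns.any fun Q ↦
        relabels (pentRows x y (Nat.beq e 1)) σ Q)) (upto 2))) (upto 32))) (upto 32)) = true := by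
  decide +kernel

theorem pentPatterns_check : (pentPatterns.all fun R ↦ pentMoves.any fun σ ↦ patterns.any fun Q ↦
    relabels R σ Q) = true := by
  decide +kernel

theorem IsPattern.relabel {V : Type*} {G : SimpleGraph V} {R σ Q : List ℕ} {f : ℕ → V}
    (hf : IsPattern G R f) (h : relabels R σ Q = true) :
    IsPattern G Q fun i ↦ f (get σ i) := by
  simp only [relabels, lall_iff, conj_iff, imp_iff, mem_I7, beq_iff, ble_iff] at h
  have hσ : ∀ i < 7, get σ i < 7 := fun i hi ↦ Nat.lt_succ_of_le (h i hi).1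
  refine ⟨fun i hi j hj hij ↦ ((h i hi).2 j hj).1 (hf.inj _ (hσ i hi) _ (hσ j hj) hij),
    fun i hi j hj ↦ ?_⟩
  rw [hf.adj _ (hσ i hi) _ (hσ j hj)]
  exact ⟨((h i hi).2 j hj).2.2, ((h i hi).2 j hj).2.1⟩

theorem IsPattern.isRamsey34 {V : Type*} {G : SimpleGraph V} {R : List ℕ} {f : ℕ → V}
    (hf : IsPattern G R f) (h3 : ∀ a b c, G.Adj a b → G.Adj b c → ¬ G.Adj a c)
    (h4 : ∀ s : Finset V, s.card = 4 → ∃ a ∈ s, ∃ b ∈ s, G.Adj a b) :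
    isRamsey34 R = true := by
  rw [ChromaticRamsey.isRamsey34, conj_iff, triFree_iff, lall_iff]
  constructor
  · intro i hi _ j hj _ hij k hk hik hjk
    rw [mem_I7] at hi hj
    have hk : k < 7 := lt_of_bit (n := 7) (by norm_num) hk
    rw [← hf.adj _ hi _ hj] at hij
    rw [← hf.adj _ hi _ hk] at hik
    rw [← hf.adj _ hj _ hk] at hjk
    exact h3 _ _ _ hij hjk hik
  · intro X hX
    rw [mem_subsets] at hX
    rw [neg_iff, indep_iff]
    intro h
    obtain ⟨a, ha, b, hb, hab⟩ := h4 (maskSet f X) (by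
      rw [card_maskSet fun i hi _ j hj _ ↦ hf.inj i hi j hj, hX.2])
    obtain ⟨i, hi, hXi, rfl⟩ := mem_maskSet.1 ha
    obtain ⟨j, hj, hXj, rfl⟩ := mem_maskSet.1 hb
    exact h i (mem_I7.2 hi) hXi j hXj ((hf.adj i hi j hj).1 hab)

/-- A graph on seven vertices without triangles and independent 4-sets that contains a pentagon is
one of the patterns. -/
theorem exists_pattern_of_pentagon {V : Type*} [Fintype V] {G : SimpleGraph V}
    (hV : Fintype.card V = 7) (h3 : ∀ a b c, G.Adj a b → G.Adj b c → ¬ G.Adj a c)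
    (h4 : ∀ s : Finset V, s.card = 4 → ∃ a ∈ s, ∃ b ∈ s, G.Adj a b) (g : ℕ → V)
    (hinj : ∀ i < 5, ∀ j < 5, g i = g j → i = j) (hadj : ∀ i < 5, G.Adj (g i) (g (i + 1)))
    (hg : g 5 = g 0) : ∃ R ∈ patterns, ∃ f, IsPattern G R f := by
  classical
  have hcard : (Finset.univ \ (Finset.range 5).image g).card = 2 := by
    rw [Finset.card_sdiff_of_subset (Finset.subset_univ _), Finset.card_univ, hV,
      Finset.card_image_of_injOn, Finset.card_range]
    intro i hi j hj hij
    exact hinj i (by simpa using hi) j (by simpa using hj) hij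
  obtain ⟨x, y, hxy, hset⟩ := Finset.card_eq_two.1 hcard
  have hx : ∀ i < 5, g i ≠ x := fun i hi h ↦ by
    have : x ∈ Finset.univ \ (Finset.range 5).image g := hset ▸ Finset.mem_insert_self _ _
    exact (Finset.mem_sdiff.1 this).2 (Finset.mem_image.2 ⟨i, Finset.mem_range.2 hi, h⟩)
  have hy : ∀ i < 5, g i ≠ y := fun i hi h ↦ by
    have : y ∈ Finset.univ \ (Finset.range 5).image g :=
      hset ▸ Finset.mem_insert_of_mem (Finset.mem_singleton_self _)
    exact (Finset.mem_sdiff.1 this).2 (Finset.mem_image.2 ⟨i, Finset.mem_range.2 hi, h⟩)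
  let f : ℕ → V := fun i ↦ if i < 5 then g i else if i = 5 then x else y
  let X := setOf (fun i ↦ decide (G.Adj x (g i))) [0, 1, 2, 3, 4]
  let Y := setOf (fun i ↦ decide (G.Adj y (g i))) [0, 1, 2, 3, 4]
  let e := decide (G.Adj x y)
  have hlt : ∀ h : ℕ → Bool, setOf h [0, 1, 2, 3, 4] < 32 := fun h ↦ by
    refine Nat.lt_of_testBit 5 ?_ rfl fun j hj ↦ ?_
    · by_contra hc
      rw [Bool.not_eq_false, ← bit_eq, bit_setOf] at hc
      simp at hc
    · have : bit (setOf h [0, 1, 2, 3, 4]) j = false := by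
        by_contra hc
        rw [Bool.not_eq_false, bit_setOf] at hc
        have := hc.1
        simp only [List.mem_cons, List.not_mem_nil, or_false] at this
        omega
      rw [← bit_eq, this, Nat.testBit_eq_false_of_lt (by
        calc 32 = 2 ^ 5 := rfl
          _ < 2 ^ j := Nat.pow_lt_pow_right (by norm_num) hj)]
  have a0 := hadj 0 (by norm_num)
  have a1 := hadj 1 (by norm_num)
  have a2 := hadj 2 (by norm_num)
  have a3 := hadj 3 (by norm_num)
  have a4 := hadj 4 (by norm_num)
  simp only [zero_add, Nat.reduceAdd, hg] at a0 a1 a2 a3 a4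
  have n02 := h3 _ _ _ a0 a1
  have n13 := h3 _ _ _ a1 a2
  have n24 := h3 _ _ _ a2 a3
  have n30 := h3 _ _ _ a3 a4
  have n41 := h3 _ _ _ a4 a0
  have bX : ∀ i < 5, (bit X i = true ↔ G.Adj x (g i)) := fun i hi ↦ by
    rw [bit_setOf, decide_eq_true_eq, and_iff_right]
    simp only [List.mem_cons, List.not_mem_nil, or_false]
    omega
  have bY : ∀ i < 5, (bit Y i = true ↔ G.Adj y (g i)) := fun i hi ↦ by
    rw [bit_setOf, decide_eq_true_eq, and_iff_right]
    simp only [List.mem_cons, List.not_mem_nil, or_false]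
    omega
  have hf : IsPattern G (pentRows X Y e) f := by
    constructor
    · intro i hi j hj hij
      by_cases h1 : i < 5 <;> by_cases h2 : j < 5
      · simp only [f, h1, h2, if_true] at hij
        exact hinj i h1 j h2 hij
      all_goals
        simp only [f, h1, h2, if_true, if_false] at hij
        split_ifs at hij
      · exact absurd hij (hx i h1)
      · exact absurd hij (hy i h1)
      · exact absurd hij.symm (hx j h2)
      · exact absurd hij.symm (hy j h2)
      · omega
      · exact absurd hij hxy
      · exact absurd hij.symm hxy
      · omega
    · intro i hi j hj
      have hget : bit (get (pentRows X Y e) i) j = true ↔ pentAdj X Y e i j = true := by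
        have : get (pentRows X Y e) i = setOf (pentAdj X Y e i) I7 := by
          interval_cases i <;> rfl
        rw [this, bit_setOf, mem_I7, and_iff_right hj]
      have bX' : ∀ i < 5, (bit X i = true ↔ G.Adj (g i) x) := fun i hi ↦ by
        rw [bX i hi, G.adj_comm]
      have bY' : ∀ i < 5, (bit Y i = true ↔ G.Adj (g i) y) := fun i hi ↦ by
        rw [bY i hi, G.adj_comm]
      have he : e = true ↔ G.Adj x y := decide_eq_true_iff
      have he' : e = true ↔ G.Adj y x := by rw [he, G.adj_comm]
      have n02' : ¬ G.Adj (g 2) (g 0) := fun h ↦ n02 h.symm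
      have n13' : ¬ G.Adj (g 3) (g 1) := fun h ↦ n13 h.symm
      have n24' : ¬ G.Adj (g 4) (g 2) := fun h ↦ n24 h.symm
      have n30' : ¬ G.Adj (g 0) (g 3) := fun h ↦ n30 h.symm
      have n41' : ¬ G.Adj (g 1) (g 4) := fun h ↦ n41 h.symm
      rw [hget]
      by_cases h1 : i < 5 <;> by_cases h2 : j < 5
      · simp only [f, h1, h2, if_true]
        interval_cases i <;> interval_cases j <;>
          simp [pentAdj, a0, a1, a2, a3, a4, a0.symm, a1.symm, a2.symm, a3.symm, a4.symm, n02, n13,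
            n24, n30, n41, n02', n13', n24', n30', n41']
      · have h3 : j = 5 ∨ j = 6 := by omega
        simp only [f, h1, if_true]
        rcases h3 with rfl | rfl
        · refine (bX' i h1).symm.trans ?_
          interval_cases i <;> rfl
        · refine (bY' i h1).symm.trans ?_
          interval_cases i <;> rfl
      · have h3 : i = 5 ∨ i = 6 := by omega
        simp only [f, h2, if_true]
        rcases h3 with rfl | rfl
        · refine (bX j h2).symm.trans ?_
          interval_cases j <;> rfl
        · refine (bY j h2).symm.trans ?_
          interval_cases j <;> rfl
      · have h3 : i = 5 ∨ i = 6 := by omega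
        have h4 : j = 5 ∨ j = 6 := by omega
        rcases h3 with rfl | rfl <;> rcases h4 with rfl | rfl
        · have h : bit X 5 = false := by
            rw [← Bool.not_eq_true, bit_setOf]
            simp
          simpa [f, pentAdj] using h
        · exact he.symm
        · exact he'.symm
        · have h : bit Y 6 = false := by
            rw [← Bool.not_eq_true, bit_setOf]
            simp
          simpa [f, pentAdj] using h
  have hind : ∀ (z : V) (Z : ℕ), (∀ i < 5, (bit Z i = true ↔ G.Adj z (g i))) →
      pentIndep Z = true := fun z Z hZ ↦ by
    simp only [pentIndep, lall_iff, imp_iff, neg_iff]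
    intro i hi h1 h2
    have hi : i < 5 := by
      simp only [List.mem_cons, List.not_mem_nil, or_false] at hi
      omega
    rw [hZ _ hi] at h1
    rw [hZ _ (Nat.mod_lt _ (by norm_num))] at h2
    have h5 : g ((i + 1) % 5) = g (i + 1) := by
      interval_cases i <;> first | rfl | exact hg.symm
    rw [h5] at h2
    exact h3 _ _ _ h1 (hadj i hi) h2
  have hcheck := pentRows_check
  simp only [lall_iff, imp_iff, mem_upto] at hcheck
  have hE : Nat.beq e.toNat 1 = e := by cases e <;> rfl
  have hR := hcheck X (hlt _) (hind x X bX) Y (hlt _) (hind y Y bY) e.toNat (Bool.toNat_lt e)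
  rw [hE] at hR
  obtain ⟨σ, -, hR⟩ := List.any_eq_true.1 (hR (hf.isRamsey34 h3 h4))
  obtain ⟨Q, hQ, hrel⟩ := List.any_eq_true.1 hR
  obtain ⟨τ, -, hR'⟩ := List.any_eq_true.1 (List.all_eq_true.1 pentPatterns_check Q hQ)
  obtain ⟨Q', hQ', hrel'⟩ := List.any_eq_true.1 hR'
  exact ⟨Q', hQ', _, (hf.relabel hrel).relabel hrel'⟩

/-- In a graph without 2-colouring, an odd closed walk of minimal length has distinct vertices. -/
theorem exists_minimal_odd_cycle {V : Type*} {G : SimpleGraph V} (h : ¬ G.Colorable 2) :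
    ∃ (n : ℕ) (g : ℕ → V), Odd n ∧ (∀ i < n, G.Adj (g i) (g (i + 1))) ∧ g n = g 0 ∧
      (∀ i < n, ∀ j < n, g i = g j → i = j) ∧ ∀ m < n, Odd m → ∀ g' : ℕ → V,
        (∀ i < m, G.Adj (g' i) (g' (i + 1))) → g' m ≠ g' 0 := by
  classical
  have hex : ∃ n, Odd n ∧ ∃ g : ℕ → V, (∀ i < n, G.Adj (g i) (g (i + 1))) ∧ g n = g 0 := by
    rw [two_colorable_iff_forall_loop_even] at h
    push Not at h
    obtain ⟨u, w, hw⟩ := h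
    exact ⟨w.length, Nat.not_even_iff_odd.1 hw, w.getVert, fun i hi ↦ w.adj_getVert_succ hi,
      by simp⟩
  obtain ⟨hodd, g, hadj, hg⟩ := Nat.find_spec hex
  set n := Nat.find hex
  have hmin : ∀ m < n, Odd m → ∀ g' : ℕ → V, (∀ i < m, G.Adj (g' i) (g' (i + 1))) →
      g' m ≠ g' 0 := fun m hm ho g' h1 h2 ↦ Nat.find_min hex hm ⟨ho, g', h1, h2⟩
  refine ⟨n, g, hodd, hadj, hg, ?_, hmin⟩
  -- a repetition would split the walk into two closed walks, one of them odd
  have key : ∀ i j, i < j → j < n → g i ≠ g j := by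
    intro i j hij hj heq
    rcases Nat.even_or_odd (j - i) with he | ho
    · refine hmin (n - (j - i)) (by omega) (by
        rcases hodd with ⟨a, ha⟩; rcases he with ⟨b, hb⟩; exact ⟨a - b, by omega⟩)
        (fun k ↦ if k ≤ i then g k else g (k + (j - i))) (fun k hk ↦ ?_) ?_
      · rcases lt_trichotomy k i with h1 | rfl | h1
        · simp only [h1.le, Nat.succ_le_of_lt h1, if_true]
          exact hadj k (by omega)
        · simp only [le_refl, if_true, Nat.not_succ_le_self, if_false]
          rw [heq, show k + 1 + (j - k) = j + 1 by omega]
          exact hadj j hj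
        · simp only [not_le.2 h1, not_le.2 (h1.trans (Nat.lt_succ_self k)), if_false]
          rw [show k + 1 + (j - i) = k + (j - i) + 1 by omega]
          exact hadj _ (by omega)
      · have h1 : ¬ n - (j - i) ≤ i := by omega
        simp only [h1, if_false, Nat.zero_le, if_true]
        rw [Nat.sub_add_cancel (by omega), hg]
    · refine hmin (j - i) (by omega) ho (fun k ↦ g (i + k)) (fun k hk ↦ hadj _ (by omega)) ?_
      simp only [add_zero]
      rw [heq, Nat.add_sub_cancel' hij.le]
  intro i hi j hj hij
  rcases lt_trichotomy i j with h1 | h1 | h1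
  · exact absurd hij (key i j h1 hj)
  · exact h1
  · exact absurd hij.symm (key j i h1 hi)

/-- A triangle-free graph on seven vertices without four independent vertices is one of the
patterns: it is not bipartite, and a shortest odd cycle has length 5 or 7. -/
theorem exists_pattern {V : Type*} [Fintype V] {G : SimpleGraph V}
    (hV : Fintype.card V = 7) (h3 : ∀ a b c, G.Adj a b → G.Adj b c → ¬ G.Adj a c)
    (h4 : ∀ s : Finset V, s.card = 4 → ∃ a ∈ s, ∃ b ∈ s, G.Adj a b) :
    ∃ R ∈ patterns, ∃ f, IsPattern G R f := by
  classical
  have hcol : ¬ G.Colorable 2 := by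
    rintro ⟨C⟩
    obtain ⟨c, hc⟩ := Fintype.exists_lt_card_fiber_of_mul_lt_card (f := C) (n := 3) (by simp [hV])
    obtain ⟨s, hs, hs4⟩ := Finset.exists_subset_card_eq (show 4 ≤ _ from hc)
    obtain ⟨a, ha, b, hb, hab⟩ := h4 s hs4
    have h1 := (Finset.mem_filter.1 (hs ha)).2
    have h2 := (Finset.mem_filter.1 (hs hb)).2
    exact C.valid hab (h1.trans h2.symm)
  obtain ⟨n, g, hodd, hadj, hg, hinj, hmin⟩ := exists_minimal_odd_cycle hcol
  have hn : n ≤ 7 := by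
    rw [← hV, ← Finset.card_range n, ← Finset.card_univ]
    exact Finset.card_le_card_of_injOn g (fun _ _ ↦ Finset.mem_univ _) fun i hi j hj hij ↦
      hinj i (by simpa using hi) j (by simpa using hj) hij
  have hcases : n = 1 ∨ n = 3 ∨ n = 5 ∨ n = 7 := by
    obtain ⟨k, rfl⟩ := hodd
    omega
  rcases hcases with rfl | rfl | rfl | rfl
  · have := hadj 0 (by norm_num)
    rw [zero_add, hg] at this
    exact absurd rfl this.ne
  · have a0 := hadj 0 (by norm_num)
    have a1 := hadj 1 (by norm_num)
    have a2 := hadj 2 (by norm_num)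
    simp only [zero_add, Nat.reduceAdd, hg] at a0 a1 a2
    exact absurd a2.symm (h3 _ _ _ a0 a1)
  · exact exists_pattern_of_pentagon hV h3 h4 g hinj hadj hg
  · refine ⟨[66, 5, 10, 20, 40, 80, 33], by simp [patterns], g, hinj, ?_⟩
    have a0 := hadj 0 (by norm_num)
    have a1 := hadj 1 (by norm_num)
    have a2 := hadj 2 (by norm_num)
    have a3 := hadj 3 (by norm_num)
    have a4 := hadj 4 (by norm_num)
    have a5 := hadj 5 (by norm_num)
    have a6 := hadj 6 (by norm_num)
    simp only [zero_add, Nat.reduceAdd, hg] at a0 a1 a2 a3 a4 a5 a6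
    -- a chord spanning two steps gives a triangle, one spanning three steps a pentagon
    have pent : ∀ a b c d e : V, G.Adj a b → G.Adj b c → G.Adj c d → G.Adj d e → ¬ G.Adj e a := by
      intro a b c d e h1 h2 h3 h4 h5
      refine hmin 5 (by norm_num) (by decide) (fun i ↦ [a, b, c, d, e, a].getD i a) ?_ rfl
      intro i hi
      interval_cases i <;> assumption
    have n2 : ∀ a b c, G.Adj a b → G.Adj b c → ¬ G.Adj a c ∧ ¬ G.Adj c a := fun a b c h1 h2 ↦
      ⟨h3 a b c h1 h2, fun h ↦ h3 a b c h1 h2 h.symm⟩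
    have n3 : ∀ a b c d e, G.Adj a b → G.Adj b c → G.Adj c d → G.Adj d e →
        ¬ G.Adj e a ∧ ¬ G.Adj a e := fun a b c d e h1 h2 h3 h4 ↦
      ⟨pent a b c d e h1 h2 h3 h4, fun h ↦ pent a b c d e h1 h2 h3 h4 h.symm⟩
    have e0 := n2 _ _ _ a0 a1
    have e1 := n2 _ _ _ a1 a2
    have e2 := n2 _ _ _ a2 a3
    have e3 := n2 _ _ _ a3 a4
    have e4 := n2 _ _ _ a4 a5
    have e5 := n2 _ _ _ a5 a6
    have e6 := n2 _ _ _ a6 a0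
    have d0 := n3 _ _ _ _ _ a0 a1 a2 a3
    have d1 := n3 _ _ _ _ _ a1 a2 a3 a4
    have d2 := n3 _ _ _ _ _ a2 a3 a4 a5
    have d3 := n3 _ _ _ _ _ a3 a4 a5 a6
    have d4 := n3 _ _ _ _ _ a4 a5 a6 a0
    have d5 := n3 _ _ _ _ _ a5 a6 a0 a1
    have d6 := n3 _ _ _ _ _ a6 a0 a1 a2
    have rows : ∀ i < 7, ∀ j < 7, bit (get [66, 5, 10, 20, 40, 80, 33] i) j =
        decide ((i + 1) % 7 = j ∨ (j + 1) % 7 = i) := by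
      intro i hi j hj
      interval_cases i <;> interval_cases j <;> rfl
    intro i hi j hj
    rw [rows i hi j hj]
    interval_cases i <;> interval_cases j <;>
      simp [a0, a1, a2, a3, a4, a5, a6, a0.symm, a1.symm, a2.symm, a3.symm, a4.symm, a5.symm,
        a6.symm, e0, e1, e2, e3, e4, e5, e6, d0, d1, d2, d3, d4, d5, d6]

/-- A 7-set without triangles, in a graph without four independent vertices, carries a pattern. -/
theorem exists_pattern_of_card {V : Type*} {G : SimpleGraph V} (X : Finset V) (hX : X.card = 7)
    (h3 : ∀ a ∈ X, ∀ b ∈ X, ∀ c ∈ X, G.Adj a b → G.Adj b c → ¬ G.Adj a c)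
    (h4 : Gᶜ.CliqueFree 4) :
    ∃ R ∈ patterns, ∃ f, IsPattern G R f ∧ ∀ i < 7, f i ∈ X := by
  classical
  obtain ⟨R, hR, f, hf⟩ := exists_pattern (G := G.induce (X : Set V)) (by simpa using hX)
    (fun a b c hab hbc hac ↦ h3 a a.2 b b.2 c c.2 hab hbc hac) (by
      intro s hs
      by_contra! hind
      refine h4 (s.map (Function.Embedding.subtype _)) ⟨?_, by rw [Finset.card_map, hs]⟩
      intro x hx y hy hxy
      obtain ⟨a, ha, rfl⟩ := Finset.mem_map.1 (Finset.mem_coe.1 hx)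
      obtain ⟨b, hb, rfl⟩ := Finset.mem_map.1 (Finset.mem_coe.1 hy)
      exact (compl_adj _ _ _).2 ⟨hxy, fun h ↦ hind a ha b hb h⟩)
  exact ⟨R, hR, fun i ↦ f i, ⟨fun i hi j hj hij ↦ hf.inj i hi j hj (Subtype.ext hij),
    fun i hi j hj ↦ hf.adj i hi j hj⟩, fun i _ ↦ (f i).2⟩

/-! ### The Moser spindle -/

/-- A 4-colourable graph maps to every graph that contains a clique on four vertices. -/
theorem cliqueFree_of_isEmpty_hom {W V : Type*} {H : SimpleGraph W} {G : SimpleGraph V}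
    (hH : H.Colorable 4) (h : IsEmpty (H →g G)) : G.CliqueFree 4 := by
  by_contra hG
  obtain ⟨C⟩ := hH
  exact h.false ((topEmbeddingOfNotCliqueFree hG).toHom.comp C)

theorem moserSpindle_colorable : moserSpindle.Colorable 4 := by
  refine ⟨Coloring.mk ![0, 1, 2, 3, 1, 2, 0] ?_⟩
  intro x y h
  have h := ((fromEdgeSet_adj _).1 h).1
  simp only [Set.mem_insert_iff, Set.mem_singleton_iff, Sym2.eq_iff] at h
  rcases h with (h | h | h | h | h | h | h | h | h | h | h) <;>
    rcases h with ⟨rfl, rfl⟩ | ⟨rfl, rfl⟩ <;> decide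

theorem nonempty_moserSpindle_hom {V : Type*} {G : SimpleGraph V} (f : Fin 7 → V)
    (h01 : G.Adj (f 0) (f 1)) (h02 : G.Adj (f 0) (f 2)) (h12 : G.Adj (f 1) (f 2))
    (h13 : G.Adj (f 1) (f 3)) (h23 : G.Adj (f 2) (f 3)) (h04 : G.Adj (f 0) (f 4))
    (h05 : G.Adj (f 0) (f 5)) (h45 : G.Adj (f 4) (f 5)) (h46 : G.Adj (f 4) (f 6))
    (h56 : G.Adj (f 5) (f 6)) (h36 : G.Adj (f 3) (f 6)) : Nonempty (moserSpindle →g G) := by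
  refine ⟨⟨f, ?_⟩⟩
  intro x y h
  have h := ((fromEdgeSet_adj _).1 h).1
  simp only [Set.mem_insert_iff, Set.mem_singleton_iff, Sym2.eq_iff] at h
  rcases h with (h | h | h | h | h | h | h | h | h | h | h) <;>
    rcases h with ⟨rfl, rfl⟩ | ⟨rfl, rfl⟩ <;>
    first | assumption | (apply SimpleGraph.Adj.symm; assumption)

/-- Whether `i` and `j` are distinct and not adjacent in the graph with rows `R`. -/
noncomputable def nonadj (R : List ℕ) (i j : ℕ) : Bool :=
  conj (neg (Nat.beq i j)) (conj (neg (bit (get R i) j)) (conj (Nat.ble i 6) (Nat.ble j 6)))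

theorem IsPattern.compl_adj {V : Type*} {G : SimpleGraph V} {R : List ℕ} {f : ℕ → V}
    (hf : IsPattern G R f) {i j : ℕ} (h : nonadj R i j = true) : Gᶜ.Adj (f i) (f j) := by
  simp only [nonadj, conj_iff, neg_iff, beq_iff, ble_iff] at h
  obtain ⟨h1, h2, h3, h4⟩ := h
  refine (SimpleGraph.compl_adj _ _ _).2 ⟨fun h ↦ h1 (hf.inj i (by omega) j (by omega) h), ?_⟩
  rwa [hf.adj i (by omega) j (by omega)]

/-- Each pattern contains a Moser spindle in its complement. -/
theorem patterns_moser_check : (patterns.all fun R ↦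
    [[3, 6, 1, 4, 5, 0, 2], [4, 5, 1, 3, 2, 6, 0], [1, 3, 6, 0, 4, 5, 2],
      [2, 4, 5, 1, 6, 0, 3]].any fun σ ↦
      [(0, 1), (0, 2), (1, 2), (1, 3), (2, 3), (0, 4), (0, 5), (4, 5), (4, 6), (5, 6),
        (3, 6)].all fun e ↦ nonadj R (get σ e.1) (get σ e.2)) = true := by
  decide +kernel

theorem nonempty_moserSpindle_hom_compl {V : Type*} {G : SimpleGraph V} (X : Finset V)
    (hX : 7 ≤ X.card) (h3 : ∀ a ∈ X, ∀ b ∈ X, ∀ c ∈ X, G.Adj a b → G.Adj b c → ¬ G.Adj a c)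
    (h4 : Gᶜ.CliqueFree 4) : Nonempty (moserSpindle →g Gᶜ) := by
  obtain ⟨Y, hY, hY7⟩ := Finset.exists_subset_card_eq hX
  obtain ⟨R, hR, f, hf, -⟩ := exists_pattern_of_card Y hY7
    (fun a ha b hb c hc ↦ h3 a (hY ha) b (hY hb) c (hY hc)) h4
  obtain ⟨σ, -, hσ⟩ := List.any_eq_true.1 (List.all_eq_true.1 patterns_moser_check R hR)
  simp only [List.all_cons, List.all_nil, Bool.and_eq_true] at hσ
  obtain ⟨h01, h02, h12, h13, h23, h04, h05, h45, h46, h56, h36, -⟩ := hσ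
  exact nonempty_moserSpindle_hom (fun i ↦ f (get σ i)) (hf.compl_adj h01) (hf.compl_adj h02)
    (hf.compl_adj h12) (hf.compl_adj h13) (hf.compl_adj h23) (hf.compl_adj h04)
    (hf.compl_adj h05) (hf.compl_adj h45) (hf.compl_adj h46) (hf.compl_adj h56)
    (hf.compl_adj h36)

/-- Neighbourhoods in a graph without cliques on four vertices are triangle-free. -/
theorem triangleFree_neighborFinset {V : Type*} [Fintype V] {G : SimpleGraph V}
    [DecidableRel G.Adj] (h : G.CliqueFree 4) (v : V) : ∀ a ∈ G.neighborFinset v,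
    ∀ b ∈ G.neighborFinset v, ∀ c ∈ G.neighborFinset v, G.Adj a b → G.Adj b c → ¬ G.Adj a c := by
  classical
  intro a ha b hb c hc hab hbc hac
  rw [mem_neighborFinset] at ha hb hc
  refine h {v, a, b, c} ⟨?_, ?_⟩
  · simp [isClique_insert, ha, hb, hc, hab, hac, hbc]
  · rw [Finset.card_eq_succ]
    refine ⟨v, {a, b, c}, ?_, rfl, Finset.card_eq_three.2 ⟨a, b, c, hab.ne, hac.ne, hbc.ne, rfl⟩⟩
    simp [ha.ne, hb.ne, hc.ne]

/-- A vertex of degree 6 would lead, through a triangle in each set of its neighbours and one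
non-neighbour, to rhombi from that vertex to all its non-neighbours, which must then be pairwise
non-adjacent. -/
theorem degree_le_five {V : Type*} [Fintype V] {G : SimpleGraph V} [DecidableRel G.Adj]
    (hV : Fintype.card V = 11) (h1 : IsEmpty (moserSpindle →g G))
    (h2 : IsEmpty (moserSpindle →g Gᶜ)) (v : V) : G.degree v ≤ 5 := by
  classical
  have k1 := cliqueFree_of_isEmpty_hom moserSpindle_colorable h1
  have k2 := cliqueFree_of_isEmpty_hom moserSpindle_colorable h2
  have htri := triangleFree_neighborFinset k1 v
  have h6 : G.degree v ≤ 6 := by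
    by_contra! h
    exact not_nonempty_iff.2 h2 (nonempty_moserSpindle_hom_compl (G.neighborFinset v) h htri k2)
  by_contra! h5
  have h6 : G.degree v = 6 := by omega
  set A := G.neighborFinset v
  have hA : A.card = 6 := h6
  have hvA : v ∉ A := by simp [A]
  set B := Finset.univ \ insert v A
  have hB : B.card = 4 := by
    rw [Finset.card_sdiff_of_subset (Finset.subset_univ _), Finset.card_univ, hV,
      Finset.card_insert_of_notMem hvA, hA]
  have rhombus : ∀ b ∈ B, ∃ x y, G.Adj v x ∧ G.Adj v y ∧ G.Adj x y ∧ G.Adj x b ∧ G.Adj y b := by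
    intro b hb
    have hbA : b ∉ A := fun h ↦ (Finset.mem_sdiff.1 hb).2 (Finset.mem_insert_of_mem h)
    by_contra! hno
    have hno' : ∀ x ∈ A, ∀ y ∈ A, G.Adj x y → G.Adj x b → ¬ G.Adj y b := fun x hx y hy ↦
      hno x y ((mem_neighborFinset _ _ _).1 hx) ((mem_neighborFinset _ _ _).1 hy)
    refine not_nonempty_iff.2 h2 (nonempty_moserSpindle_hom_compl (insert b A) (by
      rw [Finset.card_insert_of_notMem hbA, hA]) ?_ k2)
    simp only [Finset.mem_insert]
    rintro a (rfl | ha) c (rfl | hc) d (rfl | hd) hac hcd had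
    · exact hac.ne rfl
    · exact hac.ne rfl
    · exact had.ne rfl
    · exact hno' c hc d hd hcd hac.symm had.symm
    · exact hcd.ne rfl
    · exact hno' a ha d hd had hac hcd.symm
    · exact hno' a ha c hc hac had hcd
    · exact htri a ha c hc d hd hac hcd had
  refine k2 B ⟨?_, hB⟩
  intro b hb b' hb' hbb
  refine (SimpleGraph.compl_adj _ _ _).2 ⟨hbb, fun hadj ↦ ?_⟩
  obtain ⟨x, y, hx, hy, hxy, hxb, hyb⟩ := rhombus b hb
  obtain ⟨z, w, hz, hw, hzw, hzb, hwb⟩ := rhombus b' hb'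
  exact not_nonempty_iff.2 h1 (nonempty_moserSpindle_hom ![v, x, y, b, z, w, b'] hx hy hxy hxb hyb
    hz hw hzw hzb hwb hadj)

/-- Every colouring of the complete graph on 11 vertices has a monochromatic image of the Moser
spindle: otherwise both colour classes would be 5-regular on 11 vertices. -/
theorem moserSpindle_upper (R : SimpleGraph (Fin 11)) :
    Nonempty (moserSpindle →g R) ∨ Nonempty (moserSpindle →g Rᶜ) := by
  classical
  by_contra! h
  have h1 := h.1
  have h2 := h.2
  have d1 := degree_le_five (by simp) h1 h2
  have d2 := degree_le_five (G := Rᶜ) (by simp) h2 (by rwa [compl_compl])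
  have hd : ∀ v, R.degree v = 5 := fun v ↦ by
    have h3 := R.degree_compl (v := v)
    have h4 := d1 v
    have h5 := d2 v
    rw [Fintype.card_fin] at h3
    omega
  have hsum := R.sum_degrees_eq_twice_card_edges
  simp only [hd, Finset.sum_const, Finset.card_univ, Fintype.card_fin, smul_eq_mul] at hsum
  omega

/-- The colouring of the complete graph on ten vertices without monochromatic image of the Moser
spindle: whether two vertices differ by at most two, cyclically. -/
def near (i j : Fin 10) : Bool := decide (i - j = 1 ∨ i - j = 2 ∨ j - i = 1 ∨ j - i = 2)

theorem circulantGraph_adj_iff_near {i j : Fin 10} :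
    (circulantGraph {1, 2}).Adj i j ↔ i ≠ j ∧ near i j = true := by
  simp only [circulantGraph_adj, near, Set.mem_insert_iff, Set.mem_singleton_iff,
    decide_eq_true_eq, or_assoc, ne_eq]

/-- The rhombi with acute vertex `v` have their other acute vertex at `v`, `v ± 3` in one colour
and at `v`, `v ± 1` in the other. -/
theorem rhombus_end (b : Bool) (v x y d : Fin 10) (hvx : v ≠ x ∧ near v x = b)
    (hvy : v ≠ y ∧ near v y = b) (hxy : x ≠ y ∧ near x y = b) (hxd : x ≠ d ∧ near x d = b)
    (hyd : y ≠ d ∧ near y d = b) : d = v ∨ d = v + cond b 3 1 ∨ d = v - cond b 3 1 := by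
  have key : ∀ b : Bool, ∀ v x : Fin 10, (v ≠ x ∧ near v x = b) → ∀ y : Fin 10,
      (v ≠ y ∧ near v y = b) → (x ≠ y ∧ near x y = b) → ∀ d : Fin 10, (x ≠ d ∧ near x d = b) →
      (y ≠ d ∧ near y d = b) → d = v ∨ d = v + cond b 3 1 ∨ d = v - cond b 3 1 := by
    decide +kernel
  exact key b v x hvx y hvy hxy d hxd hyd

/-- Two rhombi on a common acute vertex have non-adjacent ends. -/
theorem not_adj_rhombus_ends (b : Bool) (v x y d z w d' : Fin 10) (hvx : v ≠ x ∧ near v x = b)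
    (hvy : v ≠ y ∧ near v y = b) (hxy : x ≠ y ∧ near x y = b) (hxd : x ≠ d ∧ near x d = b)
    (hyd : y ≠ d ∧ near y d = b) (hvz : v ≠ z ∧ near v z = b) (hvw : v ≠ w ∧ near v w = b)
    (hzw : z ≠ w ∧ near z w = b) (hzd : z ≠ d' ∧ near z d' = b) (hwd : w ≠ d' ∧ near w d' = b) :
    ¬ (d ≠ d' ∧ near d d' = b) := by
  have key : ∀ b : Bool, ∀ v d d' : Fin 10, (d = v ∨ d = v + cond b 3 1 ∨ d = v - cond b 3 1) →
      (d' = v ∨ d' = v + cond b 3 1 ∨ d' = v - cond b 3 1) → ¬ (d ≠ d' ∧ near d d' = b) := by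
    decide +kernel
  exact key b v d d' (rhombus_end b v x y d hvx hvy hxy hxd hyd)
    (rhombus_end b v z w d' hvz hvw hzw hzd hwd)

theorem moserSpindle_adj {i j : Fin 7} (h : s(i, j) ∈ ({s(0, 1), s(0, 2), s(1, 2), s(1, 3),
    s(2, 3), s(0, 4), s(0, 5), s(4, 5), s(4, 6), s(5, 6), s(3, 6)} : Set (Sym2 (Fin 7))))
    (hij : i ≠ j) : moserSpindle.Adj i j :=
  (fromEdgeSet_adj _).2 ⟨h, hij⟩

theorem isEmpty_hom_of_rhombi {V : Type*} {G : SimpleGraph V}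
    (h : ∀ v x y d z w d', G.Adj v x → G.Adj v y → G.Adj x y → G.Adj x d → G.Adj y d →
      G.Adj v z → G.Adj v w → G.Adj z w → G.Adj z d' → G.Adj w d' → ¬ G.Adj d d') :
    IsEmpty (moserSpindle →g G) := by
  refine ⟨fun φ ↦ ?_⟩
  have e : ∀ i j : Fin 7, s(i, j) ∈ ({s(0, 1), s(0, 2), s(1, 2), s(1, 3), s(2, 3), s(0, 4),
      s(0, 5), s(4, 5), s(4, 6), s(5, 6), s(3, 6)} : Set (Sym2 (Fin 7))) → i ≠ j →
      G.Adj (φ i) (φ j) := fun i j h hij ↦ φ.map_adj (moserSpindle_adj h hij)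
  exact h (φ 0) (φ 1) (φ 2) (φ 3) (φ 4) (φ 5) (φ 6) (e _ _ (by simp) (by decide))
    (e _ _ (by simp) (by decide)) (e _ _ (by simp) (by decide)) (e _ _ (by simp) (by decide))
    (e _ _ (by simp) (by decide)) (e _ _ (by simp) (by decide)) (e _ _ (by simp) (by decide))
    (e _ _ (by simp) (by decide)) (e _ _ (by simp) (by decide)) (e _ _ (by simp) (by decide))
    (e _ _ (by simp) (by decide))

theorem chromaticRamseyNumber_moserSpindle : chromaticRamseyNumber moserSpindle = 11 := by
  refine chromaticRamseyNumber_eq moserSpindle 10 moserSpindle_upper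
    (circulantGraph {1, 2}) (isEmpty_hom_of_rhombi ?_) (isEmpty_hom_of_rhombi ?_)
  · have h : ∀ i j : Fin 10, (circulantGraph {1, 2}).Adj i j → i ≠ j ∧ near i j = true :=
      fun i j ↦ circulantGraph_adj_iff_near.1
    intro v x y d z w d' h1 h2 h3 h4 h5 h6 h7 h8 h9 h10 h11
    exact not_adj_rhombus_ends true v x y d z w d' (h _ _ h1) (h _ _ h2) (h _ _ h3) (h _ _ h4)
      (h _ _ h5) (h _ _ h6) (h _ _ h7) (h _ _ h8) (h _ _ h9) (h _ _ h10) (h _ _ h11)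
  · have h : ∀ i j : Fin 10, (circulantGraph {1, 2})ᶜ.Adj i j → i ≠ j ∧ near i j = false :=
      fun i j h ↦ by
        have h := (SimpleGraph.compl_adj _ _ _).1 h
        exact ⟨h.1, Bool.not_eq_true _ ▸ fun hn ↦ h.2 (circulantGraph_adj_iff_near.2 ⟨h.1, hn⟩)⟩
    intro v x y d z w d' h1 h2 h3 h4 h5 h6 h7 h8 h9 h10 h11
    exact not_adj_rhombus_ends false v x y d z w d' (h _ _ h1) (h _ _ h2) (h _ _ h3) (h _ _ h4)
      (h _ _ h5) (h _ _ h6) (h _ _ h7) (h _ _ h8) (h _ _ h9) (h _ _ h10) (h _ _ h11)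

/-! ### The square of the 8-cycle -/

theorem cayleyZ8_adj : ∀ {i j : ZMod 8}, cayleyZ8.Adj i j ↔
    j = i + 1 ∨ j = i + 2 ∨ i = j + 1 ∨ i = j + 2 := by
  intro i j
  simp only [cayleyZ8, addCayley_adj', Set.mem_insert_iff, Set.mem_singleton_iff]
  revert i j
  decide

theorem cayleyZ8_colorable : cayleyZ8.Colorable 4 := by
  have key : ∀ x y : ZMod 8, (y = x + 1 ∨ y = x + 2 ∨ x = y + 1 ∨ x = y + 2) →
      Fin.ofNat 4 x.val ≠ Fin.ofNat 4 y.val := by decide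
  exact ⟨Coloring.mk (fun i ↦ Fin.ofNat 4 i.val) fun {x y} h ↦ key x y (cayleyZ8_adj.1 h)⟩

theorem nonempty_cayleyZ8_hom {V : Type*} {G : SimpleGraph V} (w : ZMod 8 → V)
    (h1 : ∀ i, G.Adj (w i) (w (i + 1))) (h2 : ∀ i, G.Adj (w i) (w (i + 2))) :
    Nonempty (cayleyZ8 →g G) := by
  refine ⟨⟨w, ?_⟩⟩
  intro i j h
  rcases cayleyZ8_adj.1 h with rfl | rfl | rfl | rfl
  exacts [h1 i, h2 i, (h1 j).symm, (h2 j).symm]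

noncomputable section

/-- Extend `nonadj` by a vertex `7` with set of neighbours `S`. -/
def nonadjExt (R : List ℕ) (S i j : ℕ) : Bool :=
  if i = 7 then conj (Nat.ble j 6) (neg (bit S j))
  else if j = 7 then conj (Nat.ble i 6) (neg (bit S i)) else nonadj R i j

end

/-- If a further vertex is joined to a pattern without creating a triangle or four independent
vertices, then the complement of the graph on eight vertices contains the square of an 8-cycle. -/
theorem patterns_cayleyZ8_check : (lall (fun S ↦ patterns.all fun R ↦
    imp (conj (indep I7 R S) (antiFree R (compl S)))
      ([[7, 3, 6, 1, 4, 5, 2, 0], [6, 2, 4, 5, 1, 3, 7, 0], [6, 4, 7, 2, 0, 5, 3, 1],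
        [5, 1, 3, 6, 0, 7, 2, 4], [2, 7, 0, 3, 6, 1, 4, 5]].any fun σ ↦
        lall (fun i ↦ conj (nonadjExt R S (get σ i) (get σ ((i + 1) % 8)))
          (nonadjExt R S (get σ i) (get σ ((i + 2) % 8)))) (upto 8))) (upto 128)) = true := by
  decide +kernel

open Classical in
/-- The numbers `j < 7` such that `b` is adjacent to `f j`, as a bit mask. -/
noncomputable def cone {V : Type*} (G : SimpleGraph V) (f : ℕ → V) (b : V) : ℕ :=
  setOf (fun j ↦ decide (G.Adj b (f j))) I7

theorem bit_cone {V : Type*} {G : SimpleGraph V} {f : ℕ → V} {b : V} {j : ℕ} :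
    bit (cone G f b) j = true ↔ j < 7 ∧ G.Adj b (f j) := by
  classical
  rw [cone, bit_setOf, mem_I7]
  exact and_congr_right fun _ ↦ decide_eq_true_iff

theorem lt_of_forall_bit {X n : ℕ} (h : ∀ i, bit X i = true → i < n) : X < 2 ^ n := by
  refine Nat.lt_of_testBit n ?_ (by simp) fun j hj ↦ ?_
  · rw [← bit_eq, ← Bool.not_eq_true]
    exact fun hc ↦ (h n hc).ne rfl
  · rw [← bit_eq, Nat.testBit_two_pow_of_ne hj.ne, ← Bool.not_eq_true]
    exact fun hc ↦ (h j hc).not_gt hj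

theorem cone_lt {V : Type*} (G : SimpleGraph V) (f : ℕ → V) (b : V) : cone G f b < 128 :=
  lt_of_forall_bit (n := 7) fun _ h ↦ (bit_cone.1 h).1

/-- The form in which the absence of cliques on four vertices is used. -/
theorem not_adj_of_cliqueFree {V : Type*} {G : SimpleGraph V} (h : G.CliqueFree 4) {a b c d : V}
    (hab : G.Adj a b) (hac : G.Adj a c) (hbc : G.Adj b c) (had : G.Adj a d) (hbd : G.Adj b d) :
    ¬ G.Adj c d := by
  classical
  intro hcd
  refine h {d, a, b, c} ?_
  exact (is3Clique_triple_iff.2 ⟨hab, hac, hbc⟩).insert fun x hx ↦ by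
    simp only [Finset.mem_insert, Finset.mem_singleton] at hx
    rcases hx with rfl | rfl | rfl
    exacts [had.symm, hbd.symm, hcd.symm]

theorem IsPattern.compl_adj_iff {V : Type*} {G : SimpleGraph V} {R : List ℕ} {f : ℕ → V}
    (hf : IsPattern G R f) {i j : ℕ} (hi : i < 7) (hj : j < 7) :
    Gᶜ.Adj (f i) (f j) ↔ i ≠ j ∧ ¬ bit (get R i) j = true := by
  rw [SimpleGraph.compl_adj, hf.adj i hi j hj]
  exact and_congr_left fun _ ↦ not_congr ⟨hf.inj i hi j hj, fun h ↦ h ▸ rfl⟩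

theorem compl_adj_iff_bit_cone {V : Type*} {G : SimpleGraph V} {f : ℕ → V} {b : V} {i : ℕ}
    (hi : i < 7) (hb : b ≠ f i) : Gᶜ.Adj b (f i) ↔ ¬ bit (cone G f b) i = true := by
  rw [SimpleGraph.compl_adj, bit_cone, and_iff_right hb, and_iff_right hi]

/-- The vertices of a pattern outside the cone of a further vertex contain no independent triple:
with that vertex they would form an independent 4-set. -/
theorem IsPattern.antiFree_compl_cone {V : Type*} {G : SimpleGraph V} {R : List ℕ} {f : ℕ → V}
    (hf : IsPattern G R f) (h4 : Gᶜ.CliqueFree 4) {b : V} (hb : ∀ i < 7, b ≠ f i) :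
    antiFree R (compl (cone G f b)) = true := by
  rw [antiFree_iff (compl_lt (cone_lt G f b))]
  intro i hi hXi j hj hXj hij hRij k hk hXk hik hRik hjk
  by_contra hRjk
  have hn : ∀ i < 7, bit (compl (cone G f b)) i = true → Gᶜ.Adj b (f i) := fun i hi h ↦ by
    rw [bit_compl _ hi] at h
    rw [compl_adj_iff_bit_cone hi (hb i hi)]
    simpa using h
  exact not_adj_of_cliqueFree h4 (hn i hi hXi) (hn j hj hXj)
    ((hf.compl_adj_iff hi hj).2 ⟨hij, hRij⟩) (hn k hk hXk) ((hf.compl_adj_iff hi hk).2 ⟨hik, hRik⟩)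
    ((hf.compl_adj_iff hj hk).2 ⟨hjk, hRjk⟩)

/-- An 8-set without triangles, in a graph without four independent vertices, contains the square
of an 8-cycle in the complement. -/
theorem nonempty_cayleyZ8_hom_compl {V : Type*} {G : SimpleGraph V} (X : Finset V)
    (hX : X.card = 8) (h3 : ∀ a ∈ X, ∀ b ∈ X, ∀ c ∈ X, G.Adj a b → G.Adj b c → ¬ G.Adj a c)
    (h4 : Gᶜ.CliqueFree 4) : Nonempty (cayleyZ8 →g Gᶜ) := by
  classical
  obtain ⟨x, hx⟩ : X.Nonempty := Finset.card_pos.1 (by omega)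
  obtain ⟨R, hR, f, hf, hfX⟩ := exists_pattern_of_card (X.erase x)
    (by rw [Finset.card_erase_of_mem hx, hX])
    (fun a ha b hb c hc ↦ h3 a (Finset.mem_of_mem_erase ha) b (Finset.mem_of_mem_erase hb) c
      (Finset.mem_of_mem_erase hc)) h4
  have hne : ∀ i < 7, x ≠ f i := fun i hi h ↦ Finset.ne_of_mem_erase (hfX i hi) h.symm
  set S := cone G f x
  have hS : indep I7 R S = true := by
    rw [indep_iff]
    intro i hi hSi j hSj hij
    obtain ⟨hi, hxi⟩ := bit_cone.1 hSi
    obtain ⟨hj, hxj⟩ := bit_cone.1 hSj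
    exact h3 x hx _ (Finset.mem_of_mem_erase (hfX i hi)) _ (Finset.mem_of_mem_erase (hfX j hj))
      hxi ((hf.adj i hi j hj).2 hij) hxj
  have hcheck := patterns_cayleyZ8_check
  simp only [lall_iff, List.all_eq_true, imp_iff, conj_iff, mem_upto, List.any_eq_true] at hcheck
  obtain ⟨σ, -, hσ⟩ := hcheck S (cone_lt G f x) R hR ⟨hS, hf.antiFree_compl_cone h4 hne⟩
  let f' : ℕ → V := fun i ↦ if i = 7 then x else f i
  have hadj : ∀ i j, nonadjExt R S i j = true → Gᶜ.Adj (f' i) (f' j) := by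
    intro i j h
    simp only [nonadjExt] at h
    simp only [f']
    split_ifs at h with h1 h2
    · rw [conj_iff, ble_iff, neg_iff] at h
      have hj : j < 7 := by omega
      rw [if_pos h1, if_neg hj.ne, compl_adj_iff_bit_cone hj (hne j hj)]
      exact h.2
    · rw [conj_iff, ble_iff, neg_iff] at h
      have hi : i < 7 := by omega
      rw [if_pos h2, if_neg h1, adj_comm, compl_adj_iff_bit_cone hi (hne i hi)]
      exact h.2
    · rw [if_neg h1, if_neg h2]
      exact hf.compl_adj h
  have hval : ∀ (i : ZMod 8), ((i + 1 : ZMod 8) : Fin 8).val = ((i : Fin 8).val + 1) % 8 ∧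
      ((i + 2 : ZMod 8) : Fin 8).val = ((i : Fin 8).val + 2) % 8 := by decide
  refine nonempty_cayleyZ8_hom (fun i : ZMod 8 ↦ f' (get σ (i : Fin 8).val)) (fun i ↦ ?_)
    fun i ↦ ?_
  · rw [(hval i).1]
    exact hadj _ _ (hσ _ (i : Fin 8).isLt).1
  · rw [(hval i).2]
    exact hadj _ _ (hσ _ (i : Fin 8).isLt).2

/-- Whether `d` is one of the differences `±1, ±3, ±4` modulo 13, or for `b = false` one of the
other nonzero differences. -/
def step (b : Bool) (d : Fin 13) : Prop :=
  (d = 1 ∨ d = 12 ∨ d = 3 ∨ d = 10 ∨ d = 4 ∨ d = 9 ↔ b = true) ∧ d ≠ 0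

instance (b : Bool) : DecidablePred (step b) := fun d ↦ by unfold step; infer_instance

theorem circulantGraph_adj_iff_step {i j : Fin 13} :
    (circulantGraph {1, 3, 4}).Adj i j ↔ step true (j - i) := by
  simp only [circulantGraph_adj, Set.mem_insert_iff, Set.mem_singleton_iff]
  revert i j
  decide +kernel

/-- Closed walks of eight steps whose consecutive vertices are joined, as are those at distance
two, do not exist in the circulant graph on 13 vertices with jumps 1, 3 and 4, nor in its
complement. -/
theorem step_sum_ne_zero : ∀ b : Bool, ∀ d₀ : Fin 13, step b d₀ → ∀ d₁ : Fin 13, step b d₁ →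
    step b (d₀ + d₁) → ∀ d₂ : Fin 13, step b d₂ → step b (d₁ + d₂) → ∀ d₃ : Fin 13, step b d₃ →
    step b (d₂ + d₃) → ∀ d₄ : Fin 13, step b d₄ → step b (d₃ + d₄) → ∀ d₅ : Fin 13, step b d₅ →
    step b (d₄ + d₅) → ∀ d₆ : Fin 13, step b d₆ → step b (d₅ + d₆) → ∀ d₇ : Fin 13, step b d₇ →
    step b (d₆ + d₇) → d₀ + d₁ + d₂ + d₃ + d₄ + d₅ + d₆ + d₇ ≠ 0 := by
  decide +kernel

theorem isEmpty_cayleyZ8_hom {b : Bool} {G : SimpleGraph (Fin 13)}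
    (hG : ∀ i j, G.Adj i j → step b (j - i)) : IsEmpty (cayleyZ8 →g G) := by
  refine ⟨fun φ ↦ ?_⟩
  have s1 : ∀ i : ZMod 8, step b (φ (i + 1) - φ i) := fun i ↦
    hG _ _ (φ.map_adj (cayleyZ8_adj.2 (.inl rfl)))
  have s2 : ∀ i j : ZMod 8, j = i + 1 → step b ((φ (i + 1) - φ i) + (φ (j + 1) - φ j)) := by
    rintro i _ rfl
    have h := hG _ _ (φ.map_adj (cayleyZ8_adj.2 (.inr (.inl (rfl : i + 2 = i + 2)))))
    have e : φ (i + 2) - φ i = (φ (i + 1) - φ i) + (φ (i + 1 + 1) - φ (i + 1)) := by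
      rw [show i + 1 + 1 = i + 2 by ring]; abel
    rwa [e] at h
  refine step_sum_ne_zero b _ (s1 0) _ (s1 1) (s2 0 1 (by decide)) _ (s1 2) (s2 1 2 (by decide)) _
    (s1 3) (s2 2 3 (by decide)) _ (s1 4) (s2 3 4 (by decide)) _ (s1 5) (s2 4 5 (by decide)) _
    (s1 6) (s2 5 6 (by decide)) _ (s1 7) (s2 6 7 (by decide)) ?_
  have e : (0 : ZMod 8) + 1 = 1 ∧ (1 : ZMod 8) + 1 = 2 ∧ (2 : ZMod 8) + 1 = 3 ∧
      (3 : ZMod 8) + 1 = 4 ∧ (4 : ZMod 8) + 1 = 5 ∧ (5 : ZMod 8) + 1 = 6 ∧ (6 : ZMod 8) + 1 = 7 ∧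
      (7 : ZMod 8) + 1 = 0 := by decide
  obtain ⟨e0, e1, e2, e3, e4, e5, e6, e7⟩ := e
  rw [e0, e1, e2, e3, e4, e5, e6, e7]
  abel

theorem cayleyZ8_lower : IsEmpty (cayleyZ8 →g (circulantGraph {1, 3, 4} : SimpleGraph (Fin 13))) ∧
    IsEmpty (cayleyZ8 →g (circulantGraph {1, 3, 4} : SimpleGraph (Fin 13))ᶜ) := by
  constructor
  · exact isEmpty_cayleyZ8_hom (b := true) fun i j ↦ circulantGraph_adj_iff_step.1
  · refine isEmpty_cayleyZ8_hom (b := false) fun i j h ↦ ?_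
    obtain ⟨h1, h2⟩ := (SimpleGraph.compl_adj _ _ _).1 h
    have h3 : j - i ≠ 0 := sub_ne_zero.2 h1.symm
    rw [circulantGraph_adj_iff_step, step, and_iff_left h3] at h2
    exact ⟨by simpa using h2, h3⟩

/-! ### The search for colourings without the square of the 8-cycle -/

noncomputable section Search

/-- The independent sets of the pattern `p`, as a set of masks. -/
def indepTab (p : List ℕ) : ℕ := setOf (indep I7 p) (upto 128)

/-- The cliques of the pattern `p`, as a set of masks. -/
def cliqueTab (p : List ℕ) : ℕ := setOf (clique I7 p) (upto 128)

/-- The `k`-sets without independent triples in the pattern `p`. -/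
def antiSets (p : List ℕ) (k : ℕ) : List ℕ := lfilter (antiFree p) (subsets 128 k)

/-- The `k`-sets that meet `S` in an independent set of the pattern `p`. -/
def indepOn (p : List ℕ) (k S : ℕ) : ℕ :=
  setOf (fun X ↦ bit (indepTab p) (Nat.land X S)) (subsets 128 k)

/-- The `k`-sets disjoint from `S`. -/
def avoiding (k S : ℕ) : ℕ := setOf (fun X ↦ disj X S) (subsets 128 k)

/-- The `k`-sets contained in `S`. -/
def inside (k S : ℕ) : ℕ := setOf (fun X ↦ subset X S) (subsets 128 k)

/-- The `k`-sets without independent triples that leave a clique of the pattern `p` outside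
`S`. -/
def cliqueOff (p : List ℕ) (k S : ℕ) : ℕ :=
  setOf (fun X ↦ bit (cliqueTab p) (Nat.land X (compl S))) (antiSets p k)

/-- The possible cones over the pattern `p`: they contain an edge, and meet all independent
triples. -/
def cones (p : List ℕ) : List ℕ :=
  lfilter (fun S ↦ conj (neg (bit (indepTab p) S)) (antiFree p (compl S))) (upto 128)

/-- Necessary condition for two adjacent vertices to have the cones `S` and `T`. -/
def redOK (p : List ℕ) (S T : ℕ) : Bool :=
  conj (bit (indepTab p) (Nat.land S T)) (conj (disj (cliqueOff p 5 S) (cliqueOff p 5 T))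
    (disj (Nat.land (indepOn p 6 S) (indepOn p 6 T)) (avoiding 6 (Nat.land S T))))

/-- Necessary condition for two non-adjacent vertices to have the cones `S` and `T`. -/
def blueOK (p : List ℕ) (S T : ℕ) : Bool :=
  conj (bit (cliqueTab p) (compl (Nat.lor S T))) (disj (indepOn p 6 S) (indepOn p 6 T))

/-- Necessary condition for the vertices of a triangle to have the cones `S`, `T` and `U`. -/
def triOK (p : List ℕ) (S T U : ℕ) : Bool :=
  conj (disj (Nat.land S T) U) (disj (Nat.land (cliqueOff p 4 S) (cliqueOff p 4 T))
    (cliqueOff p 4 U))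

/-- The cones that a vertex may have which is adjacent to a vertex with cone `S` (for `e = true`)
or not adjacent to it (for `e = false`). -/
def partners (p : List ℕ) (e : Bool) (S : ℕ) : ℕ :=
  Bool.rec (setOf (blueOK p S) (cones p)) (setOf (redOK p S) (cones p)) e

/-- The cones that a vertex may have whose neighbours in a triangle with cones `s`, `t`, `u` are
given by the three bits of `m`. -/
def attached (p : List ℕ) (s t u m : ℕ) : ℕ :=
  Nat.land (partners p (bit m 0) s)
    (Nat.land (partners p (bit m 1) t) (partners p (bit m 2) u))

/-- Whether `triOK` holds for all triangles formed by a vertex with cone `a` and two vertices of a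
triangle with cones `s`, `t`, `u`; the adjacencies are given by the three bits of `m`. -/
def attachedOK (p : List ℕ) (s t u m a : ℕ) : Bool :=
  conj (imp (conj (bit m 0) (bit m 1)) (triOK p s t a))
    (conj (imp (conj (bit m 0) (bit m 2)) (triOK p s u a))
      (imp (conj (bit m 1) (bit m 2)) (triOK p t u a)))

/-- The sum of `16 ^ i` over `i ∈ S`. -/
def spread (S : ℕ) : ℕ :=
  List.rec 0 (fun i _ ih ↦ Nat.add ih
    (Nat.mul (Nat.land (Nat.shiftRight S i) 1) (Nat.pow 16 i))) I7

/-- The degrees in the pattern `p`, plus 3, as hexadecimal digits. -/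
def degBase (p : List ℕ) : ℕ :=
  List.rec 0 (fun i _ ih ↦ Nat.add ih (Nat.mul (Nat.add 3 (card (get p i))) (Nat.pow 16 i))) I7

/-- Whether the vertices of the pattern `p` get degrees 6 or 7: besides its neighbours in the
pattern, each of them is adjacent to the apex and to one vertex for each cone in `S` that
contains it. With the offset of `degBase`, all hexadecimal digits must be 8 or 9. -/
def degOK (p S : List ℕ) : Bool :=
  Nat.beq (Nat.land (Nat.add (degBase p) (List.rec 0 (fun s _ ih ↦ Nat.add (spread s) ih) S))
    0xEEEEEEE) 0x8888888

/-- The value of `F` at entry `i` of the list `S`. Unlike in `F (get S i)`, the kernel finds the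
entry before it enters `F`, so that it computes each value once and reuses it for other lists. -/
def atEntry {α : Type} (d : α) (S : List ℕ) (i : ℕ) (F : ℕ → α) : α :=
  List.rec (fun _ ↦ d) (fun a _ ih i ↦ Nat.rec (F a) (fun n _ ↦ ih n) i) S i

/-- The 4-sets of the pattern `p` that form no triangle with one or two elements of `X`, for six
vertices with cones `S` and adjacency rows `R`. -/
def noMixedTri (p S R : List ℕ) (X : ℕ) : ℕ :=
  foldIn (fun i ↦ Nat.land (atEntry 0 S i (indepOn p 4))
    (foldIn (fun j ↦ atEntry 0 S i fun s ↦ atEntry 0 S j fun t ↦ avoiding 4 (Nat.land s t))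
      (Nat.land X (Nat.land (get R i) (Nat.sub (Nat.pow 2 i) 1))))) X

/-- The 4-sets of the pattern `p` without independent triples that form no independent triple with
one or two elements of `X` either, for six vertices with cones `S` and adjacency rows `R`. -/
def noMixedAnti (p S R : List ℕ) (X : ℕ) : ℕ :=
  foldIn (fun i ↦ Nat.land (atEntry 0 S i (cliqueOff p 4))
    (foldIn (fun j ↦ atEntry 0 S i fun s ↦ atEntry 0 S j fun t ↦ inside 4 (Nat.lor s t))
      (Nat.land X (Nat.land (Nat.xor 63 (get R i)) (Nat.sub (Nat.pow 2 i) 1))))) X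

/-- Necessary conditions on six vertices with cones `S` over the pattern `p` and adjacency rows
`R`: the degrees of the vertices of the pattern are 6 or 7, `triOK` holds for all triangles, and no
4-set of the pattern forms with four of the six vertices an 8-set without triangles or without
independent triples. -/
def feasible (p S R : List ℕ) : Bool :=
  conj (degOK p S)
  (conj (lall (fun i ↦ lall (fun j ↦ imp (bit (Nat.mod (get R i) (Nat.pow 2 i)) j)
    (lall (fun k ↦ imp (conj (bit (Nat.mod (get R i) (Nat.pow 2 j)) k) (bit (get R j) k))
      (atEntry false S i fun s ↦ atEntry false S j fun t ↦ atEntry false S k fun u ↦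
        triOK p s t u)) I6)) I6) I6)
  (lall (fun X ↦ conj (imp (triFree I6 R X) (Nat.beq (noMixedTri p S R X) 0))
    (Nat.beq (noMixedAnti p S R X) 0)) (subsets 64 4)))

/-- The set `{k}` if `b` holds, and the empty set otherwise. -/
def single (b : Bool) (k : ℕ) : ℕ := Bool.rec 0 (Nat.pow 2 k) b

/-- Row `i` of the adjacency matrix in `rows`, for a vertex `i` of the triangle with the other
two vertices `k`. -/
def triRow (m m' m'' i k : ℕ) : ℕ :=
  Nat.lor k (Nat.lor (single (bit m i) 3) (Nat.lor (single (bit m' i) 4) (single (bit m'' i) 5)))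

/-- The adjacency rows of a graph with a triangle `0, 1, 2`, in which `m`, `m'`, `m''` are the sets
of neighbours in the triangle of the vertices `3`, `4`, `5`, and `e`, `e'`, `e''` tell whether
`34`, `35`, `45` are edges. -/
def rows (m m' m'' : ℕ) (e e' e'' : Bool) : List ℕ :=
  [triRow m m' m'' 0 6, triRow m m' m'' 1 5, triRow m m' m'' 2 3,
    Nat.lor m (Nat.lor (single e 4) (single e' 5)),
    Nat.lor m' (Nat.lor (single e 3) (single e'' 5)),
    Nat.lor m'' (Nat.lor (single e' 3) (single e'' 4))]

/-- Whether two vertices with neighbours `m` and `n` in a triangle may be adjacent (for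
`e = true`) or non-adjacent: they have at most one common neighbour in the triangle, so that there
is no clique on four vertices, or no common non-neighbour. -/
def pairOK (e : Bool) (m n : ℕ) : Bool :=
  Bool.rec (Nat.beq (Nat.lor m n) 7)
    (Nat.beq (Nat.land (Nat.land m n) (Nat.sub (Nat.land m n) 1)) 0) e

/-- No sixth vertex, with neighbours `m''` in the triangle and adjacencies `e'`, `e''` to the
fourth and fifth vertex, completes five vertices with cones `s`, `t`, `u`, `a`, `b`. -/
def noSixth (p : List ℕ) (s t u m a m' b : ℕ) (e' e'' : Bool) : Bool :=
  lall (fun m'' ↦ imp (conj (pairOK e' m m'') (pairOK e'' m' m''))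
    (lallIn (Nat.land (attached p s t u m'') (Nat.land (partners p e' a) (partners p e'' b)))
      (fun c ↦ neg (feasible p [s, t, u, a, b, c] (rows m m' m'' false e' e''))) (cones p))) I7

/-- A triangle with cones `s`, `t`, `u` cannot be completed by three vertices of which the first
two are not adjacent. -/
def noNonadjacent (p : List ℕ) (s t u : ℕ) : Bool :=
  lall (fun m ↦ lallIn (attached p s t u m) (fun a ↦ imp (attachedOK p s t u m a)
    (lall (fun m' ↦ imp (Nat.beq (Nat.lor m m') 7)
      (lallIn (Nat.land (partners p false a) (attached p s t u m'))
        (fun b ↦ imp (attachedOK p s t u m' b)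
          (conj (noSixth p s t u m a m' b true true) (conj (noSixth p s t u m a m' b true false)
            (noSixth p s t u m a m' b false true)))) (cones p))) I7)) (cones p)) [3, 5, 6]

/-- Two triangles with cones `s`, `t`, `u` and `a`, `b`, `c` cannot be joined. -/
def noTriangles (p : List ℕ) (s t u a b c : ℕ) : Bool :=
  lall (fun m ↦ imp (conj (bit (attached p s t u m) a) (attachedOK p s t u m a))
    (lall (fun m' ↦ imp (conj (bit (attached p s t u m') b) (attachedOK p s t u m' b))
      (lall (fun m'' ↦ imp (conj (bit (attached p s t u m'') c) (attachedOK p s t u m'' c))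
        (neg (feasible p [s, t, u, a, b, c] (rows m m' m'' true true true)))) I7)) I7)) I7

/-- The cones `T ≤ S` of neighbours of a vertex with cone `S`. -/
def lows (p : List ℕ) (S : ℕ) : List ℕ :=
  lfilter (bit (Nat.mod (partners p true S) (Nat.pow 2 (Nat.succ S)))) (cones p)

/-- The smallest cones of triangles in which the two other cones are `S` and `T`. -/
def thirds (p : List ℕ) (S T : ℕ) : List ℕ :=
  lfilter (fun U ↦ conj (bit (partners p true S) U) (triOK p S T U)) (lows p T)

/-- Whether `f` holds at all triples `s ≥ t ≥ u` in `X` that can be the cones of a triangle. -/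
def allTriangles (p : List ℕ) (X : ℕ) (f : ℕ → ℕ → ℕ → Bool) : Bool :=
  lallIn X (fun s ↦ lallIn X (fun t ↦ lallIn X (f s t) (thirds p s t)) (lows p s)) (cones p)

/-- The cones that are possible beside a triangle with cones `s`, `t`, `u`. -/
def beside (p : List ℕ) (s t u : ℕ) : ℕ :=
  Nat.land (Nat.lor (partners p true s) (partners p false s))
    (Nat.land (Nat.lor (partners p true t) (partners p false t))
      (Nat.lor (partners p true u) (partners p false u)))

/-- No triangle can be completed by three vertices that do not form a triangle. -/
def searchNonadjacent (p : List ℕ) : Bool :=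
  allTriangles p (Nat.sub (Nat.pow 2 128) 1) (noNonadjacent p)

/-- No two triangles can be joined. -/
def searchTriangles (p : List ℕ) : Bool :=
  allTriangles p (Nat.sub (Nat.pow 2 128) 1) fun s t u ↦
    allTriangles p (beside p s t u) fun a b c ↦
      imp (conj (Nat.ble a s) (degOK p [s, t, u, a, b, c])) (noTriangles p s t u a b c)

end Search

/-! ### Constraints on the cones over the neighbourhood of a vertex of degree seven -/

/-- The properties of a graph used below if neither it nor its complement contains a homomorphic
image of the square of the 8-cycle. -/
structure IsGood {V : Type*} (G : SimpleGraph V) : Prop where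
  cliqueFree : G.CliqueFree 4
  cliqueFree_compl : Gᶜ.CliqueFree 4
  exists_triangle : ∀ X : Finset V, X.card = 8 →
    ∃ a ∈ X, ∃ b ∈ X, ∃ c ∈ X, G.Adj a b ∧ G.Adj b c ∧ G.Adj a c
  exists_triangle_compl : ∀ X : Finset V, X.card = 8 →
    ∃ a ∈ X, ∃ b ∈ X, ∃ c ∈ X, Gᶜ.Adj a b ∧ Gᶜ.Adj b c ∧ Gᶜ.Adj a c

theorem IsGood.compl {V : Type*} {G : SimpleGraph V} (h : IsGood G) : IsGood Gᶜ :=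
  ⟨h.2, by rw [compl_compl]; exact h.1, h.4, by rw [compl_compl]; exact h.3⟩

theorem IsGood.of_isEmpty {V : Type*} {G : SimpleGraph V} (h1 : IsEmpty (cayleyZ8 →g G))
    (h2 : IsEmpty (cayleyZ8 →g Gᶜ)) : IsGood G := by
  have k1 := cliqueFree_of_isEmpty_hom cayleyZ8_colorable h1
  have k2 := cliqueFree_of_isEmpty_hom cayleyZ8_colorable h2
  refine ⟨k1, k2, fun X hX ↦ ?_, fun X hX ↦ ?_⟩
  · by_contra! h
    exact not_nonempty_iff.2 h2 (nonempty_cayleyZ8_hom_compl X hX h k2)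
  · by_contra! h
    have := nonempty_cayleyZ8_hom_compl (G := Gᶜ) X hX h (by rwa [compl_compl])
    rw [compl_compl] at this
    exact not_nonempty_iff.2 h1 this

/-- A triangle in the union of two sets has three, two, one or no vertices in the first. -/
theorem exists_triangle_union {V : Type*} {H : SimpleGraph V}
    (hH : ∀ X : Finset V, X.card = 8 →
      ∃ a ∈ X, ∃ b ∈ X, ∃ c ∈ X, H.Adj a b ∧ H.Adj b c ∧ H.Adj a c)
    (X Y : Finset V) (hXY : Disjoint X Y) (hcard : X.card + Y.card = 8) :
    (∃ a ∈ X, ∃ b ∈ X, ∃ c ∈ X, H.Adj a b ∧ H.Adj b c ∧ H.Adj a c) ∨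
    (∃ a ∈ X, ∃ b ∈ X, ∃ c ∈ Y, H.Adj a b ∧ H.Adj c a ∧ H.Adj c b) ∨
    (∃ a ∈ X, ∃ b ∈ Y, ∃ c ∈ Y, H.Adj b c ∧ H.Adj b a ∧ H.Adj c a) ∨
    ∃ a ∈ Y, ∃ b ∈ Y, ∃ c ∈ Y, H.Adj a b ∧ H.Adj b c ∧ H.Adj a c := by
  classical
  obtain ⟨a, ha, b, hb, c, hc, hab, hbc, hac⟩ := hH (X ∪ Y) (by
    rw [Finset.card_union_of_disjoint hXY, hcard])
  rcases Finset.mem_union.1 ha with ha | ha <;> rcases Finset.mem_union.1 hb with hb | hb <;>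
    rcases Finset.mem_union.1 hc with hc | hc
  · exact .inl ⟨a, ha, b, hb, c, hc, hab, hbc, hac⟩
  · exact .inr (.inl ⟨a, ha, b, hb, c, hc, hab, hac.symm, hbc.symm⟩)
  · exact .inr (.inl ⟨a, ha, c, hc, b, hb, hac, hab.symm, hbc⟩)
  · exact .inr (.inr (.inl ⟨a, ha, b, hb, c, hc, hbc, hab.symm, hac.symm⟩))
  · exact .inr (.inl ⟨b, hb, c, hc, a, ha, hbc, hab, hac⟩)
  · exact .inr (.inr (.inl ⟨b, hb, a, ha, c, hc, hac, hab, hbc.symm⟩))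
  · exact .inr (.inr (.inl ⟨c, hc, a, ha, b, hb, hab, hac, hbc⟩))
  · exact .inr (.inr (.inr ⟨a, ha, b, hb, c, hc, hab, hbc, hac⟩))

/-- A good graph with a vertex `v` of degree seven whose neighbours `f 0, …, f 6` induce the
pattern `p`. -/
structure IsApex {V : Type*} (G : SimpleGraph V) (p : List ℕ) (f : ℕ → V) (v : V) : Prop extends
    IsPattern G p f, IsGood G where
  apex : ∀ i < 7, G.Adj v (f i)

section Apex

variable {V : Type*} {G : SimpleGraph V} {p : List ℕ} {f : ℕ → V} {v : V}

theorem IsPattern.indep_iff (hf : IsPattern G p f) {X : ℕ} (hX : X < 128) :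
    indep I7 p X = true ↔
      ∀ i < 7, bit X i = true → ∀ j < 7, bit X j = true → ¬ G.Adj (f i) (f j) := by
  rw [ChromaticRamsey.indep_iff]
  simp only [mem_I7]
  refine forall₂_congr fun i hi ↦ imp_congr_right fun _ ↦ ?_
  constructor
  · exact fun h j hj hXj hadj ↦ h j hXj ((hf.adj i hi j hj).1 hadj)
  · intro h j hXj hR
    have hj := lt_of_bit (n := 7) hX hXj
    exact h j hj hXj ((hf.adj i hi j hj).2 hR)

theorem IsPattern.clique_iff (hf : IsPattern G p f) {X : ℕ} (hX : X < 128) :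
    clique I7 p X = true ↔
      ∀ i < 7, bit X i = true → ∀ j < 7, bit X j = true → ¬ Gᶜ.Adj (f i) (f j) := by
  rw [ChromaticRamsey.clique_iff]
  simp only [mem_I7]
  refine forall₂_congr fun i hi ↦ imp_congr_right fun _ ↦ ?_
  constructor
  · intro h j hj hXj hadj
    obtain ⟨h1, h2⟩ := (hf.compl_adj_iff hi hj).1 hadj
    exact h2 (h j hXj h1)
  · intro h j hXj hij
    have hj := lt_of_bit (n := 7) hX hXj
    by_contra hR
    exact h j hj hXj ((hf.compl_adj_iff hi hj).2 ⟨hij, hR⟩)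

theorem IsPattern.not_compl_triangle (hf : IsPattern G p f) {X : ℕ} (hX : X < 128)
    (h : antiFree p X = true) {i j k : ℕ} (hi : i < 7) (hXi : bit X i = true) (hj : j < 7)
    (hXj : bit X j = true) (hk : k < 7) (hXk : bit X k = true) (hij : Gᶜ.Adj (f i) (f j))
    (hjk : Gᶜ.Adj (f j) (f k)) : ¬ Gᶜ.Adj (f i) (f k) := by
  intro hik
  rw [hf.compl_adj_iff hi hj] at hij
  rw [hf.compl_adj_iff hj hk] at hjk
  rw [hf.compl_adj_iff hi hk] at hik
  exact hjk.2 ((antiFree_iff hX).1 h i hi hXi j hj hXj hij.1 hij.2 k hk hXk hik.1 hik.2 hjk.1)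

theorem bit_indepTab {X : ℕ} : bit (indepTab p) X = true ↔ X < 128 ∧ indep I7 p X = true := by
  rw [indepTab, bit_setOf, mem_upto]

theorem bit_cliqueTab {X : ℕ} : bit (cliqueTab p) X = true ↔ X < 128 ∧ clique I7 p X = true := by
  rw [cliqueTab, bit_setOf, mem_upto]

theorem bit_indepOn {k S X : ℕ} : bit (indepOn p k S) X = true ↔
    (X < 128 ∧ card X = k) ∧ indep I7 p (Nat.land X S) = true := by
  rw [indepOn, bit_setOf, mem_subsets, bit_indepTab]
  exact and_congr_right fun h ↦ and_iff_right (land_lt h.1)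

theorem bit_avoiding {k S X : ℕ} : bit (avoiding k S) X = true ↔
    (X < 128 ∧ card X = k) ∧ disj X S = true := by
  rw [avoiding, bit_setOf, mem_subsets]

theorem bit_inside {k S X : ℕ} : bit (inside k S) X = true ↔
    (X < 128 ∧ card X = k) ∧ subset X S = true := by
  rw [inside, bit_setOf, mem_subsets]

theorem bit_cliqueOff {k S X : ℕ} : bit (cliqueOff p k S) X = true ↔
    ((X < 128 ∧ card X = k) ∧ antiFree p X = true) ∧
      clique I7 p (Nat.land X (compl S)) = true := by
  rw [cliqueOff, bit_setOf, antiSets, mem_lfilter, mem_subsets, bit_cliqueTab]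
  exact and_congr_right fun h ↦ and_iff_right (land_lt h.1.1)

theorem IsApex.ne (h : IsApex G p f v) {x : V} (hx : Gᶜ.Adj v x) {i : ℕ} (hi : i < 7) :
    x ≠ f i := fun he ↦
  ((compl_adj _ _ _).1 hx).2 (he ▸ h.apex i hi)

theorem IsApex.not_triangle (h : IsApex G p f v) {i j k : ℕ} (hi : i < 7) (hj : j < 7)
    (hk : k < 7) (hij : G.Adj (f i) (f j)) (hjk : G.Adj (f j) (f k)) : ¬ G.Adj (f i) (f k) :=
  fun hik ↦ not_adj_of_cliqueFree h.cliqueFree (h.apex i hi) (h.apex j hj) hij (h.apex k hk) hik hjk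

/-- Non-neighbours of the apex do not contain a triangle of the complement. -/
theorem IsApex.not_compl_triangle (h : IsApex G p f v) {x y z : V} (hx : Gᶜ.Adj v x)
    (hy : Gᶜ.Adj v y) (hz : Gᶜ.Adj v z) (hxy : Gᶜ.Adj x y) (hyz : Gᶜ.Adj y z) : ¬ Gᶜ.Adj x z :=
  fun hxz ↦ not_adj_of_cliqueFree h.cliqueFree_compl hx hy hxy hz hxz hyz

theorem disjoint_maskSet {P : Finset V} {Q : ℕ} (hP : ∀ x ∈ P, ∀ i < 7, x ≠ f i) :
    Disjoint (maskSet f Q) P := by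
  rw [Finset.disjoint_left]
  intro x hx hxP
  obtain ⟨i, hi, -, rfl⟩ := mem_maskSet.1 hx
  exact hP _ hxP i hi rfl

/-- The triangle in an 8-set made of `Q` and a set `P` of non-neighbours of the apex. -/
theorem IsApex.exists_triangle_mixed (h : IsApex G p f v) {Q : ℕ} (hQ : Q < 128) (P : Finset V)
    (hP : ∀ x ∈ P, Gᶜ.Adj v x) (hcard : card Q + P.card = 8) :
    (∃ x ∈ P, ¬ indep I7 p (Nat.land Q (cone G f x)) = true) ∨
    (∃ x ∈ P, ∃ y ∈ P, G.Adj x y ∧ ∃ i, bit Q i = true ∧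
      bit (cone G f x) i = true ∧ bit (cone G f y) i = true) ∨
    ∃ x ∈ P, ∃ y ∈ P, ∃ z ∈ P, G.Adj x y ∧ G.Adj y z ∧ G.Adj x z := by
  rcases exists_triangle_union h.exists_triangle (maskSet f Q) P
    (disjoint_maskSet fun x hx i hi ↦ h.ne (hP x hx) hi)
    (by rw [card_maskSet fun i hi _ j hj _ ↦ h.inj i hi j hj, hcard]) with
    ⟨a, ha, b, hb, c, hc, hab, hbc, hac⟩ | ⟨a, ha, b, hb, x, hx, hab, hxa, hxb⟩ |
    ⟨a, ha, x, hx, y, hy, hxy, hxa, hya⟩ | ht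
  · obtain ⟨i, hi, -, rfl⟩ := mem_maskSet.1 ha
    obtain ⟨j, hj, -, rfl⟩ := mem_maskSet.1 hb
    obtain ⟨k, hk, -, rfl⟩ := mem_maskSet.1 hc
    exact absurd hac (h.not_triangle hi hj hk hab hbc)
  · obtain ⟨i, hi, hQi, rfl⟩ := mem_maskSet.1 ha
    obtain ⟨j, hj, hQj, rfl⟩ := mem_maskSet.1 hb
    refine .inl ⟨x, hx, fun hind ↦ ?_⟩
    exact (h.toIsPattern.indep_iff (land_lt hQ)).1 hind i hi
      (by rw [bit_land, hQi, bit_cone.2 ⟨hi, hxa⟩]; rfl) j hj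
      (by rw [bit_land, hQj, bit_cone.2 ⟨hj, hxb⟩]; rfl) hab
  · obtain ⟨i, hi, hQi, rfl⟩ := mem_maskSet.1 ha
    exact .inr (.inl ⟨x, hx, y, hy, hxy, i, hQi, bit_cone.2 ⟨hi, hxa⟩, bit_cone.2 ⟨hi, hya⟩⟩)
  · exact .inr (.inr ht)

/-- The independent triple in an 8-set made of `Q` and a further set `P`. -/
theorem IsApex.exists_compl_triangle_mixed (h : IsApex G p f v) {Q : ℕ} (hQ : Q < 128)
    (hanti : antiFree p Q = true) (P : Finset V) (hP : ∀ x ∈ P, ∀ i < 7, x ≠ f i)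
    (hcard : card Q + P.card = 8) :
    (∃ x ∈ P, ¬ clique I7 p (Nat.land Q (compl (cone G f x))) = true) ∨
    (∃ x ∈ P, ∃ y ∈ P, Gᶜ.Adj x y ∧ ∃ i < 7, bit Q i = true ∧
      ¬ bit (cone G f x) i = true ∧ ¬ bit (cone G f y) i = true) ∨
    ∃ x ∈ P, ∃ y ∈ P, ∃ z ∈ P, Gᶜ.Adj x y ∧ Gᶜ.Adj y z ∧ Gᶜ.Adj x z := by
  rcases exists_triangle_union h.exists_triangle_compl (maskSet f Q) P (disjoint_maskSet hP)
    (by rw [card_maskSet fun i hi _ j hj _ ↦ h.inj i hi j hj, hcard]) with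
    ⟨a, ha, b, hb, c, hc, hab, hbc, hac⟩ | ⟨a, ha, b, hb, x, hx, hab, hxa, hxb⟩ |
    ⟨a, ha, x, hx, y, hy, hxy, hxa, hya⟩ | ht
  · obtain ⟨i, hi, hQi, rfl⟩ := mem_maskSet.1 ha
    obtain ⟨j, hj, hQj, rfl⟩ := mem_maskSet.1 hb
    obtain ⟨k, hk, hQk, rfl⟩ := mem_maskSet.1 hc
    exact absurd hac (h.toIsPattern.not_compl_triangle hQ hanti hi hQi hj hQj hk hQk hab hbc)
  · obtain ⟨i, hi, hQi, rfl⟩ := mem_maskSet.1 ha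
    obtain ⟨j, hj, hQj, rfl⟩ := mem_maskSet.1 hb
    rw [compl_adj_iff_bit_cone hi (hP x hx i hi)] at hxa
    rw [compl_adj_iff_bit_cone hj (hP x hx j hj)] at hxb
    refine .inl ⟨x, hx, fun hcl ↦ ?_⟩
    exact (h.toIsPattern.clique_iff (land_lt hQ)).1 hcl i hi
      (by rw [bit_land, hQi, bit_compl _ hi]; simpa using hxa) j hj
      (by rw [bit_land, hQj, bit_compl _ hj]; simpa using hxb) hab
  · obtain ⟨i, hi, hQi, rfl⟩ := mem_maskSet.1 ha
    rw [compl_adj_iff_bit_cone hi (hP x hx i hi)] at hxa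
    rw [compl_adj_iff_bit_cone hi (hP y hy i hi)] at hya
    exact .inr (.inl ⟨x, hx, y, hy, hxy, i, hi, hQi, hxa, hya⟩)
  · exact .inr (.inr ht)

theorem clique_zero : clique I7 p 0 = true := by
  simp [ChromaticRamsey.clique_iff, bit_zero]

/-- The apex can be added to the further vertices: it is joined to all of `Q`. -/
theorem IsApex.exists_compl_triangle_apex (h : IsApex G p f v) {Q : ℕ} (hQ : Q < 128)
    (hanti : antiFree p Q = true) (P : Finset V) (hP : ∀ x ∈ P, Gᶜ.Adj v x)
    (hcard : card Q + P.card = 7) :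
    (∃ x ∈ P, ¬ clique I7 p (Nat.land Q (compl (cone G f x))) = true) ∨
    ∃ x ∈ P, ∃ y ∈ P, Gᶜ.Adj x y := by
  classical
  have hvP : v ∉ P := fun hv ↦ (hP v hv).ne rfl
  have hv : ∀ i < 7, bit (cone G f v) i = true := fun i hi ↦ bit_cone.2 ⟨hi, h.apex i hi⟩
  rcases h.exists_compl_triangle_mixed hQ hanti (insert v P) (fun x hx i hi ↦ by
      rcases Finset.mem_insert.1 hx with rfl | hx
      · exact (h.apex i hi).ne
      · exact h.ne (hP x hx) hi)
    (by rw [Finset.card_insert_of_notMem hvP]; omega) with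
    ⟨x, hx, hc⟩ | ⟨x, hx, y, hy, hxy, i, hi, -, hix, hiy⟩ | ⟨x, hx, y, hy, z, hz, hxy, hyz, hxz⟩
  · rcases Finset.mem_insert.1 hx with rfl | hx
    · refine absurd ?_ hc
      have h0 : Nat.land Q (compl (cone G f x)) = 0 := by
        refine beq_iff.1 (disj_iff.2 fun i hQi hi ↦ ?_)
        have h7 := lt_of_bit (n := 7) hQ hQi
        rw [bit_compl _ h7, hv i h7] at hi
        simp at hi
      rw [h0]
      exact clique_zero
    · exact .inl ⟨x, hx, hc⟩
  · rcases Finset.mem_insert.1 hx with rfl | hx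
    · exact absurd (hv i hi) hix
    rcases Finset.mem_insert.1 hy with rfl | hy
    · exact absurd (hv i hi) hiy
    exact .inr ⟨x, hx, y, hy, hxy⟩
  · rcases Finset.mem_insert.1 hx with rfl | hx'
    · exact .inr ⟨y, Finset.mem_of_mem_insert_of_ne hy hxy.ne.symm, z,
        Finset.mem_of_mem_insert_of_ne hz hxz.ne.symm, hyz⟩
    rcases Finset.mem_insert.1 hy with rfl | hy'
    · exact .inr ⟨x, hx', z, Finset.mem_of_mem_insert_of_ne hz hyz.ne.symm, hxz⟩
    exact .inr ⟨x, hx', y, hy', hxy⟩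

theorem IsApex.cone_mem_cones (h : IsApex G p f v) {x : V} (hx : Gᶜ.Adj v x)
    (hind : ¬ indep I7 p (cone G f x) = true) : cone G f x ∈ cones p := by
  rw [cones, mem_lfilter, mem_upto, conj_iff, neg_iff, bit_indepTab]
  exact ⟨cone_lt G f x, fun hc ↦ hind hc.2,
    h.toIsPattern.antiFree_compl_cone h.cliqueFree_compl fun i hi ↦ h.ne hx hi⟩

/-- A non-neighbour of the apex forms a triangle with two neighbours of the apex. -/
theorem IsApex.not_indep_cone (h : IsApex G p f v) {x : V} (hx : Gᶜ.Adj v x) :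
    ¬ indep I7 p (cone G f x) = true := by
  intro hind
  have hQ : card 127 = 7 := rfl
  have h127 : Nat.land 127 (cone G f x) = cone G f x := by
    refine Nat.eq_of_testBit_eq fun i ↦ ?_
    rw [← bit_eq, ← bit_eq, bit_land]
    by_cases hb : bit (cone G f x) i = true
    · have hi := (bit_cone.1 hb).1
      have : bit 127 i = true := by interval_cases i <;> rfl
      rw [this, hb]; rfl
    · rw [Bool.not_eq_true] at hb
      rw [hb, Bool.and_false]
  rcases h.exists_triangle_mixed (Q := 127) (by norm_num) {x} (by simpa using hx)
    (by rw [hQ, Finset.card_singleton]) with ⟨y, hy, hc⟩ | ⟨y, hy, z, hz, hyz, -⟩ |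
      ⟨y, hy, z, hz, w, hw, hyz, -⟩
  · rw [Finset.mem_singleton.1 hy, h127] at hc
    exact hc hind
  · rw [Finset.mem_singleton.1 hy, Finset.mem_singleton.1 hz] at hyz
    exact hyz.ne rfl
  · rw [Finset.mem_singleton.1 hy, Finset.mem_singleton.1 hz] at hyz
    exact hyz.ne rfl

theorem IsApex.mem_cones (h : IsApex G p f v) {x : V} (hx : Gᶜ.Adj v x) :
    cone G f x ∈ cones p :=
  h.cone_mem_cones hx (h.not_indep_cone hx)

theorem forall_mem_pair [DecidableEq V] {P : V → Prop} {x y : V} (hx : P x) (hy : P y) :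
    ∀ z ∈ ({x, y} : Finset V), P z := by
  simp only [Finset.mem_insert, Finset.mem_singleton, forall_eq_or_imp, forall_eq]
  exact ⟨hx, hy⟩

theorem forall_mem_triple [DecidableEq V] {P : V → Prop} {x y z : V} (hx : P x) (hy : P y)
    (hz : P z) : ∀ w ∈ ({x, y, z} : Finset V), P w := by
  simp only [Finset.mem_insert, Finset.mem_singleton, forall_eq_or_imp, forall_eq]
  exact ⟨hx, hy, hz⟩

theorem IsApex.redOK (h : IsApex G p f v) {x y : V} (hx : Gᶜ.Adj v x) (hy : Gᶜ.Adj v y)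
    (hxy : G.Adj x y) : redOK p (cone G f x) (cone G f y) = true := by
  classical
  simp only [ChromaticRamsey.redOK, conj_iff]
  refine ⟨bit_indepTab.2 ⟨land_lt (cone_lt G f x), ?_⟩, disj_iff.2 fun Q hQx hQy ↦ ?_,
    disj_iff.2 fun Q hQ hQ' ↦ ?_⟩
  · rw [h.toIsPattern.indep_iff (land_lt (cone_lt G f x))]
    intro i hi hXi j hj hXj hij
    rw [bit_land, Bool.and_eq_true, bit_cone, bit_cone] at hXi hXj
    exact not_adj_of_cliqueFree h.cliqueFree hxy hXi.1.2 hXi.2.2 hXj.1.2 hXj.2.2 hij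
  · obtain ⟨⟨⟨hQ, hc⟩, ha⟩, hcx⟩ := bit_cliqueOff.1 hQx
    have hcy := (bit_cliqueOff.1 hQy).2
    rcases h.exists_compl_triangle_apex hQ ha {x, y} (forall_mem_pair hx hy)
      (by rw [hc, Finset.card_pair hxy.ne]) with ⟨z, hz, hcz⟩ | ⟨z, hz, w, hw, hzw⟩
    · rcases Finset.mem_insert.1 hz with rfl | hz
      · exact hcz hcx
      · rw [Finset.mem_singleton.1 hz] at hcz
        exact hcz hcy
    · simp only [Finset.mem_insert, Finset.mem_singleton] at hz hw
      rcases hz with rfl | rfl <;> rcases hw with rfl | rfl <;>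
        simp_all [SimpleGraph.adj_comm]
  · rw [bit_land, Bool.and_eq_true, bit_indepOn, bit_indepOn] at hQ
    obtain ⟨⟨⟨hQ, hc⟩, hix⟩, -, hiy⟩ := hQ
    have hav := disj_iff.1 (bit_avoiding.1 hQ').2
    rcases h.exists_triangle_mixed hQ {x, y} (forall_mem_pair hx hy)
      (by rw [hc, Finset.card_pair hxy.ne]) with ⟨z, hz, hcz⟩ |
        ⟨z, hz, w, hw, hzw, i, hQi, hzi, hwi⟩ |
        ⟨a, ha, b, hb, c, hc, hab, hbc, hac⟩
    · rcases Finset.mem_insert.1 hz with rfl | hz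
      · exact hcz hix
      · rw [Finset.mem_singleton.1 hz] at hcz
        exact hcz hiy
    · refine hav i hQi ?_
      simp only [Finset.mem_insert, Finset.mem_singleton] at hz hw
      rcases hz with rfl | rfl <;> rcases hw with rfl | rfl
      · exact absurd rfl hzw.ne
      · rw [bit_land, hzi, hwi]; rfl
      · rw [bit_land, hzi, hwi]; rfl
      · exact absurd rfl hzw.ne
    · simp only [Finset.mem_insert, Finset.mem_singleton] at ha hb hc
      rcases ha with rfl | rfl <;> rcases hb with rfl | rfl <;> rcases hc with rfl | rfl <;>
        simp_all

theorem IsApex.blueOK (h : IsApex G p f v) {x y : V} (hx : Gᶜ.Adj v x) (hy : Gᶜ.Adj v y)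
    (hxy : Gᶜ.Adj x y) : blueOK p (cone G f x) (cone G f y) = true := by
  classical
  have hlt : compl (Nat.lor (cone G f x) (cone G f y)) < 128 :=
    compl_lt (lor_lt (cone_lt G f x) (cone_lt G f y))
  simp only [ChromaticRamsey.blueOK, conj_iff]
  refine ⟨bit_cliqueTab.2 ⟨hlt, ?_⟩, disj_iff.2 fun Q hQx hQy ↦ ?_⟩
  · rw [h.toIsPattern.clique_iff hlt]
    have key : ∀ i < 7, bit (compl (Nat.lor (cone G f x) (cone G f y))) i = true →
        Gᶜ.Adj x (f i) ∧ Gᶜ.Adj y (f i) := fun i hi hb ↦ by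
      rw [bit_compl _ hi, bit_lor] at hb
      rw [compl_adj_iff_bit_cone hi (h.ne hx hi), compl_adj_iff_bit_cone hi (h.ne hy hi)]
      simpa using hb
    intro i hi hXi j hj hXj hij
    exact not_adj_of_cliqueFree h.cliqueFree_compl hxy (key i hi hXi).1 (key i hi hXi).2
      (key j hj hXj).1 (key j hj hXj).2 hij
  · obtain ⟨⟨hQ, hc⟩, hix⟩ := bit_indepOn.1 hQx
    have hiy := (bit_indepOn.1 hQy).2
    have hn : ∀ z ∈ ({x, y} : Finset V), ∀ w ∈ ({x, y} : Finset V), ¬ G.Adj z w := by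
      intro z hz w hw hzw
      simp only [Finset.mem_insert, Finset.mem_singleton] at hz hw
      rw [SimpleGraph.compl_adj] at hxy
      rcases hz with rfl | rfl <;> rcases hw with rfl | rfl
      exacts [hzw.ne rfl, hxy.2 hzw, hxy.2 hzw.symm, hzw.ne rfl]
    rcases h.exists_triangle_mixed hQ {x, y} (forall_mem_pair hx hy)
      (by rw [hc, Finset.card_pair hxy.ne]) with ⟨z, hz, hcz⟩ | ⟨z, hz, w, hw, hzw, -⟩ |
        ⟨a, ha, b, hb, c, hc, hab, hbc, hac⟩
    · rcases Finset.mem_insert.1 hz with rfl | hz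
      · exact hcz hix
      · rw [Finset.mem_singleton.1 hz] at hcz
        exact hcz hiy
    · exact hn z hz w hw hzw
    · exact hn a ha b hb hab

theorem IsApex.triOK (h : IsApex G p f v) {x y z : V} (hx : Gᶜ.Adj v x) (hy : Gᶜ.Adj v y)
    (hz : Gᶜ.Adj v z) (hxy : G.Adj x y) (hxz : G.Adj x z) (hyz : G.Adj y z) :
    triOK p (cone G f x) (cone G f y) (cone G f z) = true := by
  classical
  simp only [ChromaticRamsey.triOK, conj_iff]
  refine ⟨disj_iff.2 fun i hi hiz ↦ ?_, disj_iff.2 fun Q hQxy hQz ↦ ?_⟩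
  · rw [bit_land, Bool.and_eq_true, bit_cone, bit_cone] at hi
    exact not_adj_of_cliqueFree h.cliqueFree hxy hxz hyz hi.1.2 hi.2.2 (bit_cone.1 hiz).2
  · rw [bit_land, Bool.and_eq_true] at hQxy
    obtain ⟨⟨⟨hQ, hc⟩, ha⟩, hcx⟩ := bit_cliqueOff.1 hQxy.1
    have hcy := (bit_cliqueOff.1 hQxy.2).2
    have hcz := (bit_cliqueOff.1 hQz).2
    rcases h.exists_compl_triangle_apex hQ ha {x, y, z} (forall_mem_triple hx hy hz)
      (by rw [hc, Finset.card_eq_three.2 ⟨x, y, z, hxy.ne, hxz.ne, hyz.ne, rfl⟩]) with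
      ⟨w, hw, hcw⟩ | ⟨w, hw, u, hu, hwu⟩
    · simp only [Finset.mem_insert, Finset.mem_singleton] at hw
      rcases hw with rfl | rfl | rfl
      exacts [hcw hcx, hcw hcy, hcw hcz]
    · simp only [Finset.mem_insert, Finset.mem_singleton] at hw hu
      obtain ⟨h1, h2⟩ := (SimpleGraph.compl_adj _ _ _).1 hwu
      rcases hw with rfl | rfl | rfl <;> rcases hu with rfl | rfl | rfl
      exacts [h1 rfl, h2 hxy, h2 hxz, h2 hxy.symm, h1 rfl, h2 hyz, h2 hxz.symm, h2 hyz.symm, h1 rfl]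

end Apex

/-! ### Soundness of the feasibility conditions -/

theorem eq_zero_of_bit {X : ℕ} (h : ∀ q, ¬ bit X q = true) : X = 0 := by
  refine Nat.eq_of_testBit_eq fun q ↦ ?_
  rw [← bit_eq, Nat.zero_testBit, ← Bool.not_eq_true]
  exact h q

theorem bit_mod_two_pow {X n j : ℕ} :
    bit (Nat.mod X (Nat.pow 2 n)) j = true ↔ j < n ∧ bit X j = true := by
  rw [bit_eq, bit_eq]
  have h : Nat.testBit (Nat.mod X (Nat.pow 2 n)) j = (decide (j < n) && X.testBit j) :=
    Nat.testBit_mod_two_pow X n j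
  rw [h, Bool.and_eq_true, decide_eq_true_eq]

theorem bit_two_pow_sub_one {n j : ℕ} :
    bit (Nat.sub (Nat.pow 2 n) 1) j = true ↔ j < n := by
  rw [bit_eq]
  have h : Nat.testBit (Nat.sub (Nat.pow 2 n) 1) j = decide (j < n) :=
    Nat.testBit_two_pow_sub_one n j
  rw [h, decide_eq_true_eq]

theorem bit_xor_63 {X j : ℕ} (hj : j < 6) : bit (Nat.xor 63 X) j = !bit X j := by
  simp only [bit_eq]
  have h : Nat.testBit 63 j = true := by interval_cases j <;> rfl
  exact (Nat.testBit_xor 63 X j).trans (by rw [h]; simp)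

theorem spread_eq (S : ℕ) :
    spread S = ∑ i ∈ Finset.range 7, (if bit S i = true then 1 else 0) * 16 ^ i := by
  simp only [Finset.sum_range_succ, Finset.sum_range_zero, ← bit_and_one]
  simp only [spread, I7, Nat.add_eq, Nat.mul_eq, Nat.pow_eq]
  omega

theorem degBase_eq (p : List ℕ) :
    degBase p = ∑ i ∈ Finset.range 7, (3 + card (get p i)) * 16 ^ i := by
  simp only [Finset.sum_range_succ, Finset.sum_range_zero]
  simp only [degBase, I7, Nat.add_eq, Nat.mul_eq, Nat.pow_eq]
  omega

theorem land_digits {d : ℕ → ℕ} (hd : ∀ i < 7, d i = 8 ∨ d i = 9) :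
    Nat.land (∑ i ∈ Finset.range 7, d i * 16 ^ i) 0xEEEEEEE = 0x8888888 := by
  simp only [Finset.sum_range_succ, Finset.sum_range_zero]
  rcases hd 0 (by norm_num) with h0 | h0 <;> rcases hd 1 (by norm_num) with h1 | h1 <;>
    rcases hd 2 (by norm_num) with h2 | h2 <;> rcases hd 3 (by norm_num) with h3 | h3 <;>
    rcases hd 4 (by norm_num) with h4 | h4 <;> rcases hd 5 (by norm_num) with h5 | h5 <;>
    rcases hd 6 (by norm_num) with h6 | h6 <;> rw [h0, h1, h2, h3, h4, h5, h6] <;> rfl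

/-- Digits stay below 16, so the sums in `degOK` have no carries and can be read digit by digit. -/
theorem degOK_of_digits {p : List ℕ} {s t u a b c : ℕ}
    (h : ∀ i < 7, ∀ d, d = 3 + card (get p i) + ((if bit s i = true then 1 else 0) +
      (if bit t i = true then 1 else 0) + (if bit u i = true then 1 else 0) +
      (if bit a i = true then 1 else 0) + (if bit b i = true then 1 else 0) +
      (if bit c i = true then 1 else 0)) → d = 8 ∨ d = 9) :
    degOK p [s, t, u, a, b, c] = true := by
  rw [degOK, beq_iff]
  have hsum := land_digits fun i hi ↦ h i hi _ rfl
  rw [← hsum]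
  congr 1
  simp only [Nat.add_eq, degBase_eq, spread_eq, add_mul, Finset.sum_add_distrib]
  omega

/-- The vertices `b 0, …, b 5` are the non-neighbours of `v`, without repetition. -/
structure IsRest {V : Type*} (G : SimpleGraph V) (v : V) (b : ℕ → V) : Prop where
  outer : ∀ i < 6, Gᶜ.Adj v (b i)
  inj : ∀ i < 6, ∀ j < 6, b i = b j → i = j
  cover : ∀ w, Gᶜ.Adj v w → ∃ i < 6, w = b i

/-- The vertices `b 0, …, b 5` are the non-neighbours of `v`, and induce the graph with adjacency
rows `R`. -/
structure IsRestRows {V : Type*} (G : SimpleGraph V) (v : V) (b : ℕ → V) (R : List ℕ) : Prop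
    extends IsRest G v b where
  adj : ∀ i < 6, ∀ j, bit (get R i) j = true ↔ j < 6 ∧ G.Adj (b i) (b j)

/-- The cones of `b 0, …, b 5`. -/
noncomputable def coneList {V : Type*} (G : SimpleGraph V) (f b : ℕ → V) : List ℕ :=
  [cone G f (b 0), cone G f (b 1), cone G f (b 2), cone G f (b 3), cone G f (b 4), cone G f (b 5)]

section Rest

variable {V : Type*} {G : SimpleGraph V} {p R : List ℕ} {f b : ℕ → V} {v : V}

theorem atEntry_coneList {α : Type} (d : α) {i : ℕ} (hi : i < 6) (F : ℕ → α) :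
    atEntry d (coneList G f b) i F = F (cone G f (b i)) := by
  interval_cases i <;> rfl

theorem IsRestRows.not_adj_of_compl (h : IsRestRows G v b R) {i j : ℕ} (hi : i < 6) (hj : j < 6)
    (hij : Gᶜ.Adj (b i) (b j)) : bit (Nat.xor 63 (get R i)) j = true := by
  rw [bit_xor_63 hj, Bool.not_eq_true', ← Bool.not_eq_true, h.adj i hi]
  exact fun hc ↦ ((compl_adj _ _ _).1 hij).2 hc.2

theorem exists_of_mem_maskSet {X : ℕ} (hX : X < 64) {x : V} (hx : x ∈ maskSet b X) :
    ∃ i < 6, bit X i = true ∧ x = b i := by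
  obtain ⟨i, -, hXi, rfl⟩ := mem_maskSet.1 hx
  exact ⟨i, lt_of_bit (n := 6) hX hXi, hXi, rfl⟩

theorem IsRestRows.card_maskSet (h : IsRestRows G v b R) {X : ℕ} (hX : X < 64) :
    (maskSet b X).card = card X :=
  ChromaticRamsey.card_maskSet fun i _ hi j _ hj ↦
    h.inj i (lt_of_bit (n := 6) hX hi) j (lt_of_bit (n := 6) hX hj)

theorem exists_bit_of_card {X : ℕ} (hX : X < 64) (hc : card X = 4) : ∃ i < 6, bit X i = true := by
  by_contra! h
  have : X = 0 := eq_zero_of_bit fun q hq ↦ h q (lt_of_bit (n := 6) hX hq) hq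
  subst this
  exact absurd hc (by decide)

/-- No 4-set of the pattern forms a triangle-free 8-set with four non-neighbours of the apex. -/
theorem IsApex.noMixedTri_eq_zero (h : IsApex G p f v) (hb : IsRestRows G v b R) {X : ℕ}
    (hX : X < 64) (hc : card X = 4) (htri : triFree I6 R X = true) :
    noMixedTri p (coneList G f b) R X = 0 := by
  refine eq_zero_of_bit fun Q hQ ↦ ?_
  have hQ := (bit_foldIn.1 hQ).2
  have h1 : ∀ i < 6, bit X i = true → bit (indepOn p 4 (cone G f (b i))) Q = true :=
    fun i hi hXi ↦ by
      have := hQ i hi hXi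
      rw [bit_land, Bool.and_eq_true, atEntry_coneList _ hi] at this
      exact this.1
  have h2 : ∀ i < 6, bit X i = true → ∀ j < i, bit X j = true → G.Adj (b i) (b j) →
      bit (avoiding 4 (Nat.land (cone G f (b i)) (cone G f (b j)))) Q = true := by
    intro i hi hXi j hj hXj hij
    have := hQ i hi hXi
    rw [bit_land, Bool.and_eq_true, bit_foldIn] at this
    have := this.2.2 j (hj.trans hi) (by
      rw [bit_land, bit_land, hXj, (hb.adj i hi j).2 ⟨hj.trans hi, hij⟩, bit_two_pow_sub_one.2 hj]
      rfl)
    rwa [atEntry_coneList _ hi, atEntry_coneList _ (hj.trans hi)] at this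
  obtain ⟨i₀, hi₀, hX₀⟩ := exists_bit_of_card hX hc
  obtain ⟨⟨hQ128, hQ4⟩, -⟩ := bit_indepOn.1 (h1 i₀ hi₀ hX₀)
  rcases h.exists_triangle_mixed hQ128 (maskSet b X) (fun x hx ↦ by
      obtain ⟨i, hi, -, rfl⟩ := exists_of_mem_maskSet hX hx
      exact hb.outer i hi) (by rw [hb.card_maskSet hX, hc, hQ4]) with
    ⟨x, hx, hcx⟩ | ⟨x, hx, y, hy, hxy, q, hQq, hxq, hyq⟩ | ⟨x, hx, y, hy, z, hz, hxy, hyz, hxz⟩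
  · obtain ⟨i, hi, hXi, rfl⟩ := exists_of_mem_maskSet hX hx
    exact hcx (bit_indepOn.1 (h1 i hi hXi)).2
  · obtain ⟨i, hi, hXi, rfl⟩ := exists_of_mem_maskSet hX hx
    obtain ⟨j, hj, hXj, rfl⟩ := exists_of_mem_maskSet hX hy
    rcases lt_trichotomy j i with hlt | rfl | hlt
    · exact disj_iff.1 (bit_avoiding.1 (h2 i hi hXi j hlt hXj hxy)).2 q hQq (by
        rw [bit_land, hxq, hyq]; rfl)
    · exact hxy.ne rfl
    · exact disj_iff.1 (bit_avoiding.1 (h2 j hj hXj i hlt hXi hxy.symm)).2 q hQq (by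
        rw [bit_land, hxq, hyq]; rfl)
  · obtain ⟨i, hi, hXi, rfl⟩ := exists_of_mem_maskSet hX hx
    obtain ⟨j, hj, hXj, rfl⟩ := exists_of_mem_maskSet hX hy
    obtain ⟨k, hk, hXk, rfl⟩ := exists_of_mem_maskSet hX hz
    exact triFree_iff.1 htri i (mem_I6.2 hi) hXi j (mem_I6.2 hj) hXj
      ((hb.adj i hi j).2 ⟨hj, hxy⟩) k hXk ((hb.adj i hi k).2 ⟨hk, hxz⟩)
      ((hb.adj j hj k).2 ⟨hk, hyz⟩)

/-- No 4-set of the pattern forms with four non-neighbours of the apex an 8-set without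
independent triples. -/
theorem IsApex.noMixedAnti_eq_zero (h : IsApex G p f v) (hb : IsRestRows G v b R) {X : ℕ}
    (hX : X < 64) (hc : card X = 4) : noMixedAnti p (coneList G f b) R X = 0 := by
  refine eq_zero_of_bit fun Q hQ ↦ ?_
  have hQ := (bit_foldIn.1 hQ).2
  have h1 : ∀ i < 6, bit X i = true → bit (cliqueOff p 4 (cone G f (b i))) Q = true :=
    fun i hi hXi ↦ by
      have := hQ i hi hXi
      rw [bit_land, Bool.and_eq_true, atEntry_coneList _ hi] at this
      exact this.1
  have h2 : ∀ i < 6, bit X i = true → ∀ j < i, bit X j = true → Gᶜ.Adj (b i) (b j) →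
      bit (inside 4 (Nat.lor (cone G f (b i)) (cone G f (b j)))) Q = true := by
    intro i hi hXi j hj hXj hij
    have := hQ i hi hXi
    rw [bit_land, Bool.and_eq_true, bit_foldIn] at this
    have := this.2.2 j (hj.trans hi) (by
      rw [bit_land, bit_land, hXj, hb.not_adj_of_compl hi (hj.trans hi) hij,
        bit_two_pow_sub_one.2 hj]
      rfl)
    rwa [atEntry_coneList _ hi, atEntry_coneList _ (hj.trans hi)] at this
  have h3 : ∀ i j q, bit (inside 4 (Nat.lor (cone G f (b i)) (cone G f (b j)))) Q = true →
      bit Q q = true → ¬ bit (cone G f (b i)) q = true → bit (cone G f (b j)) q = true := by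
    intro i j q hin hQq hi
    have := subset_iff.1 (bit_inside.1 hin).2 q hQq
    rw [bit_lor, Bool.or_eq_true] at this
    exact this.resolve_left hi
  obtain ⟨i₀, hi₀, hX₀⟩ := exists_bit_of_card hX hc
  obtain ⟨⟨⟨hQ128, hQ4⟩, hanti⟩, -⟩ := bit_cliqueOff.1 (h1 i₀ hi₀ hX₀)
  rcases h.exists_compl_triangle_mixed hQ128 hanti (maskSet b X) (fun x hx k hk ↦ by
      obtain ⟨i, hi, -, rfl⟩ := exists_of_mem_maskSet hX hx
      exact h.ne (hb.outer i hi) hk) (by rw [hb.card_maskSet hX, hc, hQ4]) with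
    ⟨x, hx, hcx⟩ | ⟨x, hx, y, hy, hxy, q, hq, hQq, hxq, hyq⟩ |
      ⟨x, hx, y, hy, z, hz, hxy, hyz, hxz⟩
  · obtain ⟨i, hi, hXi, rfl⟩ := exists_of_mem_maskSet hX hx
    exact hcx (bit_cliqueOff.1 (h1 i hi hXi)).2
  · obtain ⟨i, hi, hXi, rfl⟩ := exists_of_mem_maskSet hX hx
    obtain ⟨j, hj, hXj, rfl⟩ := exists_of_mem_maskSet hX hy
    rcases lt_trichotomy j i with hlt | rfl | hlt
    · exact hyq (h3 i j q (h2 i hi hXi j hlt hXj hxy) hQq hxq)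
    · exact hxy.ne rfl
    · exact hxq (h3 j i q (h2 j hj hXj i hlt hXi hxy.symm) hQq hyq)
  · obtain ⟨i, hi, -, rfl⟩ := exists_of_mem_maskSet hX hx
    obtain ⟨j, hj, -, rfl⟩ := exists_of_mem_maskSet hX hy
    obtain ⟨k, hk, -, rfl⟩ := exists_of_mem_maskSet hX hz
    exact h.not_compl_triangle (hb.outer i hi) (hb.outer j hj) (hb.outer k hk) hxy hyz hxz

/-- The neighbours of a vertex of the pattern are the apex, vertices of the pattern, and the
vertices whose cone contains it. -/
theorem IsApex.degree_eq [Fintype V] [DecidableRel G.Adj] (h : IsApex G p f v)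
    (hcov : ∀ w, G.Adj v w → ∃ i < 7, w = f i) (hb : IsRestRows G v b R) {k : ℕ} (hk : k < 7) :
    G.degree (f k) = 1 + card (get p k) +
      ((Finset.range 6).filter fun i ↦ bit (cone G f (b i)) k = true).card := by
  classical
  have hset : G.neighborFinset (f k) = insert v
      ((((Finset.range 7).filter fun i ↦ bit (get p k) i = true).image f) ∪
        (((Finset.range 6).filter fun i ↦ bit (cone G f (b i)) k = true).image b)) := by
    ext w
    simp only [mem_neighborFinset, Finset.mem_insert, Finset.mem_union, Finset.mem_image,
      Finset.mem_filter, Finset.mem_range, bit_cone]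
    constructor
    · intro hw
      by_cases hv : w = v
      · exact .inl hv
      by_cases hvw : G.Adj v w
      · obtain ⟨i, hi, rfl⟩ := hcov w hvw
        exact .inr (.inl ⟨i, ⟨hi, (h.adj k hk i hi).1 hw⟩, rfl⟩)
      · obtain ⟨i, hi, rfl⟩ := hb.cover w ((compl_adj _ _ _).2 ⟨Ne.symm hv, hvw⟩)
        exact .inr (.inr ⟨i, ⟨hi, hk, hw.symm⟩, rfl⟩)
    · rintro (rfl | ⟨i, ⟨hi, hki⟩, rfl⟩ | ⟨i, ⟨-, -, hki⟩, rfl⟩)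
      · exact (h.apex k hk).symm
      · exact (h.adj k hk i hi).2 hki
      · exact hki.symm
  rw [← card_neighborFinset_eq_degree, hset, Finset.card_insert_of_notMem,
    Finset.card_union_of_disjoint, Finset.card_image_of_injOn, Finset.card_image_of_injOn, card_eq]
  · omega
  · intro i hi j hj hij
    simp only [Finset.coe_filter, Finset.mem_range, Set.mem_ofPred_eq] at hi hj
    exact hb.inj i hi.1 j hj.1 hij
  · intro i hi j hj hij
    simp only [Finset.coe_filter, Finset.mem_range, Set.mem_ofPred_eq] at hi hj
    exact h.inj i hi.1 j hj.1 hij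
  · rw [Finset.disjoint_left]
    intro w hw hw'
    simp only [Finset.mem_image, Finset.mem_filter, Finset.mem_range] at hw hw'
    obtain ⟨i, ⟨hi, -⟩, rfl⟩ := hw
    obtain ⟨j, ⟨hj, -⟩, hij⟩ := hw'
    exact h.ne (hb.outer j hj) hi hij
  · simp only [Finset.mem_union, Finset.mem_image, Finset.mem_filter, Finset.mem_range]
    rintro (⟨i, ⟨hi, -⟩, hv⟩ | ⟨i, ⟨hi, -⟩, hv⟩)
    · exact (h.apex i hi).ne hv.symm
    · exact (hb.outer i hi).ne hv.symm

theorem IsApex.degOK [Fintype V] [DecidableRel G.Adj] (h : IsApex G p f v)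
    (hcov : ∀ w, G.Adj v w → ∃ i < 7, w = f i) (hb : IsRestRows G v b R)
    (hdeg : ∀ w, G.degree w = 6 ∨ G.degree w = 7) : degOK p (coneList G f b) = true := by
  refine degOK_of_digits fun k hk d hd ↦ ?_
  have h1 := h.degree_eq hcov hb hk
  have h2 := hdeg (f k)
  rw [Finset.card_filter, Finset.sum_range_succ, Finset.sum_range_succ, Finset.sum_range_succ,
    Finset.sum_range_succ, Finset.sum_range_succ, Finset.sum_range_succ,
    Finset.sum_range_zero] at h1
  omega

theorem IsApex.feasible [Fintype V] [DecidableRel G.Adj] (h : IsApex G p f v)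
    (hcov : ∀ w, G.Adj v w → ∃ i < 7, w = f i) (hb : IsRestRows G v b R)
    (hdeg : ∀ w, G.degree w = 6 ∨ G.degree w = 7) : feasible p (coneList G f b) R = true := by
  simp only [ChromaticRamsey.feasible, conj_iff, lall_iff, imp_iff, mem_I6, mem_subsets, beq_iff,
    bit_mod_two_pow]
  refine ⟨h.degOK hcov hb hdeg, fun i hi j hj hij k hk hijk ↦ ?_, fun X hX ↦
    ⟨h.noMixedTri_eq_zero hb hX.1 hX.2, h.noMixedAnti_eq_zero hb hX.1 hX.2⟩⟩
  rw [atEntry_coneList _ hi, atEntry_coneList _ hj, atEntry_coneList _ hk]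
  exact h.triOK (hb.outer i hi) (hb.outer j hj) (hb.outer k hk) ((hb.adj i hi j).1 hij.2).2
    ((hb.adj i hi k).1 hijk.1.2).2 ((hb.adj j hj k).1 hijk.2).2

end Rest

/-! ### Soundness of the search -/

section

variable {V : Type*} {G : SimpleGraph V} {p : List ℕ} {f b : ℕ → V} {v : V}

open Classical in
/-- The `j < 3` such that `x` is adjacent to `b j`, as a bit mask. -/
noncomputable def foot (G : SimpleGraph V) (b : ℕ → V) (x : V) : ℕ :=
  setOf (fun j ↦ decide (G.Adj x (b j))) [0, 1, 2]

theorem bit_foot {x : V} {j : ℕ} : bit (foot G b x) j = true ↔ j < 3 ∧ G.Adj x (b j) := by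
  classical
  rw [foot, bit_setOf]
  refine and_congr ?_ decide_eq_true_iff
  simp only [List.mem_cons, List.not_mem_nil, or_false]
  omega

theorem foot_lt (G : SimpleGraph V) (b : ℕ → V) (x : V) : foot G b x < 8 :=
  lt_of_forall_bit (n := 3) fun _ h ↦ (bit_foot.1 h).1

theorem bit_single {e : Bool} {k j : ℕ} : bit (single e k) j = true ↔ e = true ∧ k = j := by
  cases e
  · simp [single, bit_zero]
  · have : single true k = Nat.pow 2 k := rfl
    rw [this, bit_pow]; simp

open Classical in
/-- The rows of the graph induced on the non-neighbours `b 0, …, b 5` of `v`, where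
`b 0, b 1, b 2` form a triangle. -/
noncomputable def restRows (G : SimpleGraph V) (b : ℕ → V) : List ℕ :=
  rows (foot G b (b 3)) (foot G b (b 4)) (foot G b (b 5)) (decide (G.Adj (b 3) (b 4)))
    (decide (G.Adj (b 3) (b 5))) (decide (G.Adj (b 4) (b 5)))

theorem restRows_eq {e e' e'' : Bool} (he : e = true ↔ G.Adj (b 3) (b 4))
    (he' : e' = true ↔ G.Adj (b 3) (b 5)) (he'' : e'' = true ↔ G.Adj (b 4) (b 5)) :
    restRows G b = rows (foot G b (b 3)) (foot G b (b 4)) (foot G b (b 5)) e e' e'' := by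
  classical
  rw [restRows, Bool.eq_iff_iff.2 (decide_eq_true_iff.trans he.symm),
    Bool.eq_iff_iff.2 (decide_eq_true_iff.trans he'.symm),
    Bool.eq_iff_iff.2 (decide_eq_true_iff.trans he''.symm)]

theorem IsRest.isRestRows (hb : IsRest G v b) (h01 : G.Adj (b 0) (b 1)) (h02 : G.Adj (b 0) (b 2))
    (h12 : G.Adj (b 1) (b 2)) : IsRestRows G v b (restRows G b) := by
  classical
  refine ⟨hb, fun i hi j ↦ ?_⟩
  have lit : ∀ k < 8, bit k j = true → j < 3 := fun k hk h ↦ lt_of_bit (n := 3) hk h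
  have tri : ∀ i k, bit (triRow (foot G b (b 3)) (foot G b (b 4)) (foot G b (b 5)) i k) j = true ↔
      bit k j = true ∨ (bit (foot G b (b 3)) i = true ∧ 3 = j) ∨
        (bit (foot G b (b 4)) i = true ∧ 4 = j) ∨ (bit (foot G b (b 5)) i = true ∧ 5 = j) := by
    intro i k
    simp only [triRow, bit_lor, Bool.or_eq_true, bit_single]
  have side : ∀ m (e e' : Bool) k l, bit (Nat.lor m (Nat.lor (single e k) (single e' l))) j = true ↔
      bit m j = true ∨ (e = true ∧ k = j) ∨ (e' = true ∧ l = j) := by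
    intro m e e' k l
    simp only [bit_lor, Bool.or_eq_true, bit_single]
  by_cases hj : j < 6
  · rw [and_iff_right hj]
    interval_cases i
    · refine (tri 0 6).trans ?_
      simp only [bit_foot]
      interval_cases j <;> simp [bit, h01, h02, G.adj_comm (b 0)]
    · refine (tri 1 5).trans ?_
      simp only [bit_foot]
      interval_cases j <;> simp [bit, h01.symm, h12, G.adj_comm (b 1)]
    · refine (tri 2 3).trans ?_
      simp only [bit_foot]
      interval_cases j <;> simp [bit, h02.symm, h12.symm, G.adj_comm (b 2)]
    · refine (side _ _ _ 4 5).trans ?_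
      simp only [bit_foot, decide_eq_true_eq]
      interval_cases j <;> simp
    · refine (side _ _ _ 3 5).trans ?_
      simp only [bit_foot, decide_eq_true_eq]
      interval_cases j <;> simp [G.adj_comm (b 4) (b 3)]
    · refine (side _ _ _ 3 4).trans ?_
      simp only [bit_foot, decide_eq_true_eq]
      interval_cases j <;> simp [G.adj_comm (b 5) (b 3), G.adj_comm (b 5) (b 4)]
  · refine iff_of_false (fun h ↦ ?_) fun h ↦ hj h.1
    have hm := fun x ↦ lit (foot G b x) (foot_lt G b x)
    interval_cases i
    · rcases (tri 0 6).1 h with h | h | h | h <;>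
        [have := lit 6 (by norm_num) h; skip; skip; skip] <;> omega
    · rcases (tri 1 5).1 h with h | h | h | h <;>
        [have := lit 5 (by norm_num) h; skip; skip; skip] <;> omega
    · rcases (tri 2 3).1 h with h | h | h | h <;>
        [have := lit 3 (by norm_num) h; skip; skip; skip] <;> omega
    · rcases (side _ _ _ 4 5).1 h with h | h | h <;> [have := hm _ h; skip; skip] <;> omega
    · rcases (side _ _ _ 3 5).1 h with h | h | h <;> [have := hm _ h; skip; skip] <;> omega
    · rcases (side _ _ _ 3 4).1 h with h | h | h <;> [have := hm _ h; skip; skip] <;> omega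

theorem IsApex.bit_partners (h : IsApex G p f v) {x y : V} (hx : Gᶜ.Adj v x) (hy : Gᶜ.Adj v y)
    (hxy : x ≠ y) {e : Bool} (he : e = true ↔ G.Adj y x) :
    bit (partners p e (cone G f x)) (cone G f y) = true := by
  cases e
  · have hyx : Gᶜ.Adj x y := (compl_adj _ _ _).2 ⟨hxy, fun hc ↦ by simpa using he.2 hc.symm⟩
    exact bit_setOf.2 ⟨h.mem_cones hy, h.blueOK hx hy hyx⟩
  · exact bit_setOf.2 ⟨h.mem_cones hy, h.redOK hx hy (he.1 rfl).symm⟩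

theorem IsApex.bit_beside (h : IsApex G p f v) {x y z w : V} (hx : Gᶜ.Adj v x) (hy : Gᶜ.Adj v y)
    (hz : Gᶜ.Adj v z) (hw : Gᶜ.Adj v w) (hxw : x ≠ w) (hyw : y ≠ w) (hzw : z ≠ w) :
    bit (beside p (cone G f x) (cone G f y) (cone G f z)) (cone G f w) = true := by
  have key : ∀ x, Gᶜ.Adj v x → x ≠ w → bit (Nat.lor (partners p true (cone G f x))
      (partners p false (cone G f x))) (cone G f w) = true := by
    intro x hx hxw
    rw [bit_lor, Bool.or_eq_true]
    by_cases ha : G.Adj w x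
    · exact .inl (h.bit_partners hx hw hxw (by simp [ha]))
    · exact .inr (h.bit_partners hx hw hxw (by simp [ha]))
  rw [beside, bit_land, bit_land, key x hx hxw, key y hy hyw, key z hz hzw]
  rfl

theorem IsApex.bit_attached (h : IsApex G p f v) (hb : IsRest G v b) {k : ℕ} (hk : 3 ≤ k)
    (hk6 : k < 6) : bit (attached p (cone G f (b 0)) (cone G f (b 1)) (cone G f (b 2))
      (foot G b (b k))) (cone G f (b k)) = true := by
  have key : ∀ j < 3, bit (partners p (bit (foot G b (b k)) j) (cone G f (b j)))
      (cone G f (b k)) = true := fun j hj ↦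
    h.bit_partners (hb.outer j (by omega)) (hb.outer k hk6)
      (fun he ↦ by have := hb.inj j (by omega) k hk6 he; omega)
      (bit_foot.trans (and_iff_right hj))
  rw [attached, bit_land, bit_land, key 0 (by norm_num), key 1 (by norm_num), key 2 (by norm_num)]
  rfl

theorem IsApex.attachedOK (h : IsApex G p f v) (hb : IsRest G v b) (h01 : G.Adj (b 0) (b 1))
    (h02 : G.Adj (b 0) (b 2)) (h12 : G.Adj (b 1) (b 2)) {k : ℕ} (hk6 : k < 6) :
    attachedOK p (cone G f (b 0)) (cone G f (b 1)) (cone G f (b 2)) (foot G b (b k))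
      (cone G f (b k)) = true := by
  have o0 := hb.outer 0 (by norm_num)
  have o1 := hb.outer 1 (by norm_num)
  have o2 := hb.outer 2 (by norm_num)
  have ok := hb.outer k hk6
  simp only [ChromaticRamsey.attachedOK, conj_iff, imp_iff, bit_foot]
  exact ⟨fun hc ↦ h.triOK o0 o1 ok h01 hc.1.2.symm hc.2.2.symm,
    fun hc ↦ h.triOK o0 o2 ok h02 hc.1.2.symm hc.2.2.symm,
    fun hc ↦ h.triOK o1 o2 ok h12 hc.1.2.symm hc.2.2.symm⟩

/-- A vertex is not adjacent to all vertices of a triangle. -/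
theorem IsApex.foot_lt_seven (h : IsApex G p f v) (h01 : G.Adj (b 0) (b 1))
    (h02 : G.Adj (b 0) (b 2)) (h12 : G.Adj (b 1) (b 2)) (x : V) : foot G b x < 7 := by
  have key : ∀ m < 8, ¬ (bit m 0 = true ∧ bit m 1 = true ∧ bit m 2 = true) → m < 7 := by decide
  refine key _ (foot_lt G b x) fun ⟨h0, h1, h2⟩ ↦ ?_
  exact not_adj_of_cliqueFree h.cliqueFree h01 h02 h12 (bit_foot.1 h0).2.symm
    (bit_foot.1 h1).2.symm (bit_foot.1 h2).2.symm

theorem IsApex.lor_foot (h : IsApex G p f v) (hb : IsRest G v b) {i j : ℕ} (hi3 : 3 ≤ i)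
    (hi : i < 6) (hj3 : 3 ≤ j) (hj : j < 6) (hij : Gᶜ.Adj (b i) (b j)) :
    Nat.lor (foot G b (b i)) (foot G b (b j)) = 7 := by
  have key : ∀ m < 8, ∀ n < 8, (∀ k < 3, bit m k = true ∨ bit n k = true) → Nat.lor m n = 7 := by
    decide
  refine key _ (foot_lt G b _) _ (foot_lt G b _) fun k hk ↦ ?_
  rw [bit_foot, bit_foot, and_iff_right hk, and_iff_right hk]
  by_contra! hno
  refine h.not_compl_triangle (hb.outer i hi) (hb.outer j hj) (hb.outer k (by omega)) hij
    ((compl_adj _ _ _).2 ⟨fun he ↦ ?_, hno.2⟩) ((compl_adj _ _ _).2 ⟨fun he ↦ ?_, hno.1⟩)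
  · have := hb.inj j hj k (by omega) he; omega
  · have := hb.inj i hi k (by omega) he; omega

theorem IsApex.pairOK (h : IsApex G p f v) (hb : IsRest G v b) (h01 : G.Adj (b 0) (b 1))
    (h02 : G.Adj (b 0) (b 2)) (h12 : G.Adj (b 1) (b 2)) {i j : ℕ} (hi3 : 3 ≤ i) (hi : i < 6)
    (hj3 : 3 ≤ j) (hj : j < 6) (hij : i ≠ j) {e : Bool} (he : e = true ↔ G.Adj (b i) (b j)) :
    pairOK e (foot G b (b i)) (foot G b (b j)) = true := by
  cases e
  · have hadj : Gᶜ.Adj (b i) (b j) := (compl_adj _ _ _).2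
      ⟨fun hc ↦ hij (hb.inj i hi j hj hc), fun hc ↦ by simpa using he.2 hc⟩
    exact beq_iff.2 (h.lor_foot hb hi3 hi hj3 hj hadj)
  · have hadj : G.Adj (b i) (b j) := he.1 rfl
    have key : ∀ m < 8, ∀ n < 8, ¬ (bit m 1 && bit n 1 && bit m 0 && bit n 0) = true →
        ¬ (bit m 2 && bit n 2 && bit m 0 && bit n 0) = true →
        ¬ (bit m 2 && bit n 2 && bit m 1 && bit n 1) = true →
        ChromaticRamsey.pairOK true m n = true := by
      decide
    have tri : ∀ k l, G.Adj (b k) (b l) → ¬ (bit (foot G b (b i)) k && bit (foot G b (b j)) k &&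
        bit (foot G b (b i)) l && bit (foot G b (b j)) l) = true := by
      intro k l hkl hc
      simp only [Bool.and_eq_true, bit_foot] at hc
      exact not_adj_of_cliqueFree h.cliqueFree hadj hc.1.1.1.2 hc.1.1.2.2 hc.1.2.2 hc.2.2 hkl
    exact key _ (foot_lt G b _) _ (foot_lt G b _) (tri 1 0 h01.symm) (tri 2 0 h02.symm)
      (tri 2 1 h12.symm)

variable [Fintype V] [DecidableRel G.Adj]

theorem IsApex.noNonadjacent_false (h : IsApex G p f v)
    (hcov : ∀ w, G.Adj v w → ∃ i < 7, w = f i) (hdeg : ∀ w, G.degree w = 6 ∨ G.degree w = 7)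
    (hb : IsRest G v b) (h01 : G.Adj (b 0) (b 1)) (h02 : G.Adj (b 0) (b 2))
    (h12 : G.Adj (b 1) (b 2)) (h34 : Gᶜ.Adj (b 3) (b 4)) (hfoot : foot G b (b 3) ∈ [3, 5, 6])
    (hs : noNonadjacent p (cone G f (b 0)) (cone G f (b 1)) (cone G f (b 2)) = true) : False := by
  classical
  have o3 := hb.outer 3 (by norm_num)
  have o4 := hb.outer 4 (by norm_num)
  have o5 := hb.outer 5 (by norm_num)
  have n34 := h34.ne
  have n35 : b 3 ≠ b 5 := fun he ↦ by have := hb.inj 3 (by norm_num) 5 (by norm_num) he; omega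
  have n45 : b 4 ≠ b 5 := fun he ↦ by have := hb.inj 4 (by norm_num) 5 (by norm_num) he; omega
  have a34 : ¬ G.Adj (b 3) (b 4) := ((compl_adj _ _ _).1 h34).2
  simp only [noNonadjacent, lall_iff, lallIn_iff, imp_iff, mem_I7, beq_iff] at hs
  have hs := hs _ hfoot _ (h.mem_cones o3) (h.bit_attached hb (by norm_num) (by norm_num))
    (h.attachedOK hb h01 h02 h12 (by norm_num)) _ (h.foot_lt_seven h01 h02 h12 (b 4))
    (h.lor_foot hb (by norm_num) (by norm_num) (by norm_num) (by norm_num) h34)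
    _ (h.mem_cones o4) (by
      rw [bit_land, h.bit_attached hb (by norm_num) (by norm_num),
        h.bit_partners o3 o4 n34 (by simp [G.adj_comm, a34])]; rfl)
    (h.attachedOK hb h01 h02 h12 (by norm_num))
  have key : ∀ e' e'', (e' = true ↔ G.Adj (b 3) (b 5)) → (e'' = true ↔ G.Adj (b 4) (b 5)) →
      ¬ noSixth p (cone G f (b 0)) (cone G f (b 1)) (cone G f (b 2)) (foot G b (b 3))
        (cone G f (b 3)) (foot G b (b 4)) (cone G f (b 4)) e' e'' = true := by
    intro e' e'' he' he'' hn
    simp only [noSixth, lall_iff, lallIn_iff, imp_iff, mem_I7, conj_iff, neg_iff] at hn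
    refine hn _ (h.foot_lt_seven h01 h02 h12 (b 5))
      ⟨h.pairOK hb h01 h02 h12 (by norm_num) (by norm_num) (by norm_num) (by norm_num)
        (by norm_num) he',
       h.pairOK hb h01 h02 h12 (by norm_num) (by norm_num) (by norm_num) (by norm_num)
        (by norm_num) he''⟩
      _ (h.mem_cones o5) (by
        rw [bit_land, bit_land, h.bit_attached hb (by norm_num) (by norm_num),
          h.bit_partners o3 o5 n35 (he'.trans (G.adj_comm _ _)),
          h.bit_partners o4 o5 n45 (he''.trans (G.adj_comm _ _))]; rfl) ?_
    have hf := h.feasible hcov (hb.isRestRows h01 h02 h12) hdeg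
    rwa [restRows_eq (e := false) (by simp [a34]) he' he''] at hf
  simp only [conj_iff] at hs
  by_cases a35 : G.Adj (b 3) (b 5) <;> by_cases a45 : G.Adj (b 4) (b 5)
  · exact key true true (by simp [a35]) (by simp [a45]) hs.1
  · exact key true false (by simp [a35]) (by simp [a45]) hs.2.1
  · exact key false true (by simp [a35]) (by simp [a45]) hs.2.2
  · exact h.not_compl_triangle o3 o4 o5 h34 ((compl_adj _ _ _).2 ⟨n45, a45⟩)
      ((compl_adj _ _ _).2 ⟨n35, a35⟩)

theorem IsApex.noTriangles_false (h : IsApex G p f v)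
    (hcov : ∀ w, G.Adj v w → ∃ i < 7, w = f i) (hdeg : ∀ w, G.degree w = 6 ∨ G.degree w = 7)
    (hb : IsRest G v b) (h01 : G.Adj (b 0) (b 1)) (h02 : G.Adj (b 0) (b 2))
    (h12 : G.Adj (b 1) (b 2)) (h34 : G.Adj (b 3) (b 4)) (h35 : G.Adj (b 3) (b 5))
    (h45 : G.Adj (b 4) (b 5))
    (hs : noTriangles p (cone G f (b 0)) (cone G f (b 1)) (cone G f (b 2)) (cone G f (b 3))
      (cone G f (b 4)) (cone G f (b 5)) = true) : False := by
  simp only [noTriangles, lall_iff, imp_iff, mem_I7, conj_iff, neg_iff] at hs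
  have key : ∀ k, 3 ≤ k → k < 6 → bit (attached p (cone G f (b 0)) (cone G f (b 1))
      (cone G f (b 2)) (foot G b (b k))) (cone G f (b k)) = true ∧
      ChromaticRamsey.attachedOK p (cone G f (b 0)) (cone G f (b 1)) (cone G f (b 2))
        (foot G b (b k)) (cone G f (b k)) = true := fun k hk hk6 ↦
    ⟨h.bit_attached hb hk hk6, h.attachedOK hb h01 h02 h12 hk6⟩
  refine hs _ (h.foot_lt_seven h01 h02 h12 (b 3)) (key 3 (by norm_num) (by norm_num))
    _ (h.foot_lt_seven h01 h02 h12 (b 4)) (key 4 (by norm_num) (by norm_num))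
    _ (h.foot_lt_seven h01 h02 h12 (b 5)) (key 5 (by norm_num) (by norm_num)) ?_
  have hf := h.feasible hcov (hb.isRestRows h01 h02 h12) hdeg
  rwa [restRows_eq (iff_of_true rfl h34) (iff_of_true rfl h35) (iff_of_true rfl h45)] at hf

end

/-- The list `l` consists of the non-neighbours of `v`, without repetition. -/
structure IsRestList {V : Type*} (G : SimpleGraph V) (v : V) (l : List V) : Prop where
  nodup : l.Nodup
  mem_iff : ∀ w, w ∈ l ↔ Gᶜ.Adj v w

theorem IsRestList.perm {V : Type*} {G : SimpleGraph V} {v : V} {l l' : List V}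
    (h : IsRestList G v l) (hl : l'.Perm l) : IsRestList G v l' :=
  ⟨hl.nodup_iff.2 h.nodup, fun w ↦ hl.mem_iff.trans (h.mem_iff w)⟩

theorem IsRestList.isRest {V : Type*} {G : SimpleGraph V} {v x₀ x₁ x₂ x₃ x₄ x₅ : V}
    (h : IsRestList G v [x₀, x₁, x₂, x₃, x₄, x₅]) :
    IsRest G v fun i ↦ [x₀, x₁, x₂, x₃, x₄, x₅].getD i x₀ := by
  refine ⟨fun i hi ↦ (h.mem_iff _).1 ?_, fun i hi j hj hij ↦ ?_, fun w hw ↦ ?_⟩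
  · rw [List.getD_eq_getElem _ _ (by simpa using hi)]
    exact List.getElem_mem _
  · rw [List.getD_eq_getElem _ _ (by simpa using hi),
      List.getD_eq_getElem _ _ (by simpa using hj)] at hij
    exact (h.nodup.getElem_inj_iff).1 hij
  · obtain ⟨i, hi, rfl⟩ := List.mem_iff_getElem.1 ((h.mem_iff w).2 hw)
    exact ⟨i, by simpa using hi, (List.getD_eq_getElem _ _ hi).symm⟩

theorem exists_sorted_triple {V : Type*} (c : V → ℕ) (x y z : V) :
    ∃ x' y' z', [x', y', z'].Perm [x, y, z] ∧ c y' ≤ c x' ∧ c z' ≤ c y' := by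
  have pxzy : [x, z, y].Perm [x, y, z] := (List.Perm.swap y z []).cons x
  have pyxz : [y, x, z].Perm [x, y, z] := List.Perm.swap x y [z]
  have pyzx : [y, z, x].Perm [x, y, z] := ((List.Perm.swap x z []).cons y).trans pyxz
  have pzxy : [z, x, y].Perm [x, y, z] := (List.Perm.swap x z [y]).trans pxzy
  have pzyx : [z, y, x].Perm [x, y, z] := (List.Perm.swap y z [x]).trans pyzx
  rcases le_total (c x) (c y) with h1 | h1 <;> rcases le_total (c y) (c z) with h2 | h2 <;>
    rcases le_total (c x) (c z) with h3 | h3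
  · exact ⟨z, y, x, pzyx, h2, h1⟩
  · exact ⟨z, y, x, pzyx, h2, h1⟩
  · exact ⟨y, z, x, pyzx, h2, h3⟩
  · exact ⟨y, x, z, pyxz, h1, h3⟩
  · exact ⟨z, x, y, pzxy, h3, h1⟩
  · exact ⟨x, z, y, pxzy, h3, h2⟩
  · exact ⟨x, y, z, .refl _, h1, h2⟩
  · exact ⟨x, y, z, .refl _, h1, h2⟩

theorem pairwise_adj_triple {V : Type*} {G : SimpleGraph V} {x y z : V} :
    [x, y, z].Pairwise G.Adj ↔ G.Adj x y ∧ G.Adj x z ∧ G.Adj y z := by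
  simp [and_assoc]

theorem mem_of_lor_eq_seven {m n : ℕ} (hm : m < 7) (hn : n < 7) (h : Nat.lor m n = 7) :
    m ∈ [3, 5, 6] ∨ n ∈ [3, 5, 6] := by
  have key : ∀ m < 7, ∀ n < 7, Nat.lor m n ≠ 7 ∨ m ∈ [3, 5, 6] ∨ n ∈ [3, 5, 6] := by decide
  exact (key m hm n hn).resolve_left fun hc ↦ hc h

theorem foot_congr {V : Type*} {G : SimpleGraph V} {b b' : ℕ → V} (h : ∀ j < 3, b j = b' j)
    (x : V) : foot G b x = foot G b' x := by
  refine Nat.eq_of_testBit_eq fun j ↦ ?_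
  rw [← bit_eq, ← bit_eq, Bool.eq_iff_iff, bit_foot, bit_foot]
  exact and_congr_right fun hj ↦ by rw [h j hj]

section

variable {V : Type*} {G : SimpleGraph V} {p : List ℕ} {f : ℕ → V} {v : V}

theorem IsApex.of_allTriangles (h : IsApex G p f v) {X : ℕ} {F : ℕ → ℕ → ℕ → Bool}
    (hs : allTriangles p X F = true) {x y z : V} (hx : Gᶜ.Adj v x) (hy : Gᶜ.Adj v y)
    (hz : Gᶜ.Adj v z) (hxyz : [x, y, z].Pairwise G.Adj) (hyx : cone G f y ≤ cone G f x)
    (hzy : cone G f z ≤ cone G f y) (hXx : bit X (cone G f x) = true)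
    (hXy : bit X (cone G f y) = true) (hXz : bit X (cone G f z) = true) :
    F (cone G f x) (cone G f y) (cone G f z) = true := by
  obtain ⟨hxy, hxz, hyz⟩ := pairwise_adj_triple.1 hxyz
  simp only [allTriangles, lallIn_iff, lows, thirds, mem_lfilter, conj_iff, bit_mod_two_pow] at hs
  exact hs _ (h.mem_cones hx) hXx
    _ ⟨h.mem_cones hy, by omega, h.bit_partners hx hy hxy.ne (by simp [hxy.symm])⟩ hXy
    _ ⟨⟨h.mem_cones hz, by omega, h.bit_partners hy hz hyz.ne (by simp [hyz.symm])⟩,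
      h.bit_partners hx hz hxz.ne (by simp [hxz.symm]), h.triOK hx hy hz hxy hxz hyz⟩ hXz

variable [Fintype V] [DecidableRel G.Adj]

/-- The non-neighbours of the apex do not consist of a triangle and three vertices of which two are
non-adjacent. -/
theorem IsApex.adj_of_searchNonadjacent (h : IsApex G p f v)
    (hcov : ∀ w, G.Adj v w → ∃ i < 7, w = f i) (hdeg : ∀ w, G.degree w = 6 ∨ G.degree w = 7)
    (hs : searchNonadjacent p = true) {x y z a b c : V}
    (hl : IsRestList G v ([x, y, z] ++ [a, b, c])) (htri : [x, y, z].Pairwise G.Adj) :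
    G.Adj a b := by
  by_contra hab
  obtain ⟨x', y', z', hperm, hyx, hzy⟩ := exists_sorted_triple (cone G f) x y z
  have htri' := (hperm.pairwise_iff (fun {_ _} h ↦ SimpleGraph.Adj.symm h)).2 htri
  have hl' := hl.perm (hperm.append_right [a, b, c])
  have hl'' := hl'.perm ((List.Perm.swap a b [c]).append_left [x', y', z'])
  have hx := (hl'.mem_iff x').1 (by simp)
  have hy := (hl'.mem_iff y').1 (by simp)
  have hz := (hl'.mem_iff z').1 (by simp)
  have hbit : ∀ w, bit (Nat.sub (Nat.pow 2 128) 1) (cone G f w) = true := fun w ↦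
    bit_two_pow_sub_one.2 (cone_lt G f w)
  have hs := h.of_allTriangles hs hx hy hz htri' hyx hzy (hbit _) (hbit _) (hbit _)
  obtain ⟨hxy, hxz, hyz⟩ := pairwise_adj_triple.1 htri'
  have hne : a ≠ b := by
    rintro rfl
    simpa using hl.nodup
  have hab' : Gᶜ.Adj a b := (compl_adj _ _ _).2 ⟨hne, hab⟩
  have r1 := IsRestList.isRest (x₀ := x') (x₁ := y') (x₂ := z') (x₃ := a) (x₄ := b) (x₅ := c) hl'
  have r2 := IsRestList.isRest (x₀ := x') (x₁ := y') (x₂ := z') (x₃ := b) (x₄ := a) (x₅ := c) hl''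
  rcases mem_of_lor_eq_seven (h.foot_lt_seven hxy hxz hyz a) (h.foot_lt_seven hxy hxz hyz b)
    (h.lor_foot r1 (i := 3) (j := 4) (by norm_num) (by norm_num) (by norm_num) (by norm_num) hab')
    with hfoot | hfoot
  · exact h.noNonadjacent_false hcov hdeg r1 hxy hxz hyz hab' hfoot hs
  · refine h.noNonadjacent_false hcov hdeg r2 hxy hxz hyz hab'.symm ?_ hs
    rwa [foot_congr fun j hj ↦ ?_] at hfoot
    interval_cases j <;> rfl

/-- The non-neighbours of the apex do not consist of two triangles. -/
theorem IsApex.not_pairwise_of_searchTriangles (h : IsApex G p f v)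
    (hcov : ∀ w, G.Adj v w → ∃ i < 7, w = f i) (hdeg : ∀ w, G.degree w = 6 ∨ G.degree w = 7)
    (hs : searchTriangles p = true) {x y z a b c : V}
    (hl : IsRestList G v ([x, y, z] ++ [a, b, c])) (htri : [x, y, z].Pairwise G.Adj) :
    ¬ [a, b, c].Pairwise G.Adj := by
  intro htri2
  -- the triangle with the largest cone comes first
  suffices key : ∀ x y z a b c : V, IsRestList G v ([x, y, z] ++ [a, b, c]) →
      [x, y, z].Pairwise G.Adj → [a, b, c].Pairwise G.Adj → cone G f y ≤ cone G f x →
      cone G f z ≤ cone G f y → cone G f b ≤ cone G f a → cone G f c ≤ cone G f b →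
      ¬ cone G f a ≤ cone G f x by
    obtain ⟨x', y', z', hp, hyx, hzy⟩ := exists_sorted_triple (cone G f) x y z
    obtain ⟨a', b', c', hp', hba, hcb⟩ := exists_sorted_triple (cone G f) a b c
    have hl := hl.perm (hp.append hp')
    have htri := (hp.pairwise_iff (fun {_ _} h ↦ SimpleGraph.Adj.symm h)).2 htri
    have htri2 := (hp'.pairwise_iff (fun {_ _} h ↦ SimpleGraph.Adj.symm h)).2 htri2
    rcases le_total (cone G f a') (cone G f x') with hle | hle
    · exact key _ _ _ _ _ _ hl htri htri2 hyx hzy hba hcb hle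
    · exact key _ _ _ _ _ _ (hl.perm List.perm_append_comm) htri2 htri hba hcb hyx hzy hle
  intro x y z a b c hl htri htri2 hyx hzy hba hcb hle
  have o : ∀ w ∈ [x, y, z] ++ [a, b, c], Gᶜ.Adj v w := fun w ↦ (hl.mem_iff w).1
  have hx := o x (by simp)
  have hy := o y (by simp)
  have hz := o z (by simp)
  have ha := o a (by simp)
  have hb := o b (by simp)
  have hc := o c (by simp)
  have hbit : ∀ w, bit (Nat.sub (Nat.pow 2 128) 1) (cone G f w) = true := fun w ↦
    bit_two_pow_sub_one.2 (cone_lt G f w)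
  have hs := h.of_allTriangles hs hx hy hz htri hyx hzy (hbit _) (hbit _) (hbit _)
  have hd := (List.nodup_append.1 hl.nodup).2.2
  have hne : ∀ w ∈ [a, b, c], ∀ u ∈ [x, y, z], u ≠ w := fun w hw u hu ↦ hd u hu w hw
  have hbes : ∀ w ∈ [a, b, c],
      bit (beside p (cone G f x) (cone G f y) (cone G f z)) (cone G f w) = true := fun w hw ↦
    h.bit_beside hx hy hz (o w (List.mem_append_right _ hw)) (hne w hw x (by simp))
      (hne w hw y (by simp)) (hne w hw z (by simp))
  have hs := h.of_allTriangles hs ha hb hc htri2 hba hcb (hbes a (by simp)) (hbes b (by simp))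
    (hbes c (by simp))
  obtain ⟨hxy, hxz, hyz⟩ := pairwise_adj_triple.1 htri
  obtain ⟨hab, hac, hbc⟩ := pairwise_adj_triple.1 htri2
  have r := IsRestList.isRest (x₀ := x) (x₁ := y) (x₂ := z) (x₃ := a) (x₄ := b) (x₅ := c) hl
  rw [imp_iff, conj_iff, ble_iff] at hs
  have hd := h.degOK hcov (r.isRestRows hxy hxz hyz) hdeg
  have hs := hs ⟨hle, hd⟩
  exact h.noTriangles_false hcov hdeg r hxy hxz hyz hab hac hbc hs

end

/-- The Ramsey number `R(3, 3) ≤ 6`. -/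
theorem exists_triangle_of_card_six {V : Type*} {G : SimpleGraph V} (B : Finset V)
    (hB : B.card = 6)
    (h : ∀ x ∈ B, ∀ y ∈ B, ∀ z ∈ B, Gᶜ.Adj x y → Gᶜ.Adj y z → ¬ Gᶜ.Adj x z) :
    ∃ x ∈ B, ∃ y ∈ B, ∃ z ∈ B, G.Adj x y ∧ G.Adj x z ∧ G.Adj y z := by
  classical
  obtain ⟨w, hw⟩ : B.Nonempty := Finset.card_pos.1 (by omega)
  have hsplit := Finset.card_filter_add_card_filter_not (s := B.erase w) (fun x ↦ G.Adj w x)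
  rw [Finset.card_erase_of_mem hw, hB] at hsplit
  by_cases h3 : 2 < ((B.erase w).filter fun x ↦ G.Adj w x).card
  · obtain ⟨x, hx, y, hy, z, hz, hxy, hxz, hyz⟩ := Finset.two_lt_card.1 h3
    simp only [Finset.mem_filter, Finset.mem_erase] at hx hy hz
    by_cases axy : G.Adj x y
    · exact ⟨w, hw, x, hx.1.2, y, hy.1.2, hx.2, hy.2, axy⟩
    by_cases axz : G.Adj x z
    · exact ⟨w, hw, x, hx.1.2, z, hz.1.2, hx.2, hz.2, axz⟩
    by_cases ayz : G.Adj y z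
    · exact ⟨w, hw, y, hy.1.2, z, hz.1.2, hy.2, hz.2, ayz⟩
    exact absurd ((compl_adj _ _ _).2 ⟨hxz, axz⟩) (h x hx.1.2 y hy.1.2 z hz.1.2
      ((compl_adj _ _ _).2 ⟨hxy, axy⟩) ((compl_adj _ _ _).2 ⟨hyz, ayz⟩))
  · have h3 : 2 < ((B.erase w).filter fun x ↦ ¬ G.Adj w x).card := by omega
    obtain ⟨x, hx, y, hy, z, hz, hxy, hxz, hyz⟩ := Finset.two_lt_card.1 h3
    simp only [Finset.mem_filter, Finset.mem_erase] at hx hy hz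
    have key : ∀ x y, (x ≠ w ∧ x ∈ B) ∧ ¬ G.Adj w x → (y ≠ w ∧ y ∈ B) ∧ ¬ G.Adj w y → x ≠ y →
        G.Adj x y := fun x y hx hy hxy ↦ by
      by_contra hn
      exact h w hw x hx.1.2 y hy.1.2 ((compl_adj _ _ _).2 ⟨hx.1.1.symm, hx.2⟩)
        ((compl_adj _ _ _).2 ⟨hxy, hn⟩) ((compl_adj _ _ _).2 ⟨hy.1.1.symm, hy.2⟩)
    exact ⟨x, hx.1.2, y, hy.1.2, z, hz.1.2, key x y hx hy hxy, key x z hx hz hxz,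
      key y z hy hz hyz⟩

/-! ### The chromatic Ramsey number of the square of the 8-cycle -/

theorem search_patterns_take : ((patterns.take 4).all fun p ↦
    conj (searchNonadjacent p) (searchTriangles p)) = true := by
  decide +kernel

theorem search_patterns_drop : ((patterns.drop 4).all fun p ↦
    conj (searchNonadjacent p) (searchTriangles p)) = true := by
  decide +kernel

/-- For none of the patterns does the search find six vertices that could be the non-neighbours of
the apex. -/
theorem search_patterns {p : List ℕ} (hp : p ∈ patterns) :
    searchNonadjacent p = true ∧ searchTriangles p = true := by
  rw [← List.take_append_drop 4 patterns, List.mem_append] at hp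
  rcases hp with hp | hp
  · exact conj_iff.1 (List.all_eq_true.1 search_patterns_take p hp)
  · exact conj_iff.1 (List.all_eq_true.1 search_patterns_drop p hp)

theorem IsGood.degree_le {V : Type*} [Fintype V] {G : SimpleGraph V} [DecidableRel G.Adj]
    (h : IsGood G) (v : V) : G.degree v ≤ 7 := by
  by_contra! hd
  obtain ⟨X, hX, hX8⟩ := Finset.exists_subset_card_eq (s := G.neighborFinset v) hd
  obtain ⟨a, ha, b, hb, c, hc, hab, hbc, hac⟩ := h.exists_triangle X hX8
  exact triangleFree_neighborFinset h.cliqueFree v a (hX ha) b (hX hb) c (hX hc) hab hbc hac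

/-- A good graph on 14 vertices with degrees 6 and 7 has no vertex of degree 7: such a vertex is
excluded by the search. -/
theorem IsGood.degree_ne_seven {V : Type*} [Fintype V] {G : SimpleGraph V} [DecidableRel G.Adj]
    (h : IsGood G) (hV : Fintype.card V = 14) (hdeg : ∀ w, G.degree w = 6 ∨ G.degree w = 7)
    (v : V) : G.degree v ≠ 7 := by
  classical
  intro hv
  have hA : (G.neighborFinset v).card = 7 := hv
  obtain ⟨p, hp, f, hf, hfA⟩ := exists_pattern_of_card (G.neighborFinset v) hA
    (triangleFree_neighborFinset h.cliqueFree v) h.cliqueFree_compl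
  have hapex : IsApex G p f v := ⟨hf, h, fun i hi ↦ (mem_neighborFinset _ _ _).1 (hfA i hi)⟩
  have himage : (Finset.range 7).image f = G.neighborFinset v := by
    refine Finset.eq_of_subset_of_card_le (fun x hx ↦ ?_) ?_
    · obtain ⟨i, hi, rfl⟩ := Finset.mem_image.1 hx
      exact hfA i (Finset.mem_range.1 hi)
    · rw [hA, Finset.card_image_of_injOn, Finset.card_range]
      intro i hi j hj hij
      exact hf.inj i (by simpa using hi) j (by simpa using hj) hij
  have hcov : ∀ w, G.Adj v w → ∃ i < 7, w = f i := fun w hw ↦ by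
    have : w ∈ (Finset.range 7).image f := himage ▸ (mem_neighborFinset _ _ _).2 hw
    obtain ⟨i, hi, rfl⟩ := Finset.mem_image.1 this
    exact ⟨i, Finset.mem_range.1 hi, rfl⟩
  have hB : (Gᶜ.neighborFinset v).card = 6 := by
    rw [card_neighborFinset_eq_degree, degree_compl, hV, hv]
  have hout : ∀ x ∈ Gᶜ.neighborFinset v, Gᶜ.Adj v x := fun x ↦ (mem_neighborFinset _ _ _).1
  obtain ⟨x, hx, y, hy, z, hz, hxy, hxz, hyz⟩ := exists_triangle_of_card_six
    (Gᶜ.neighborFinset v) hB fun x hx y hy z hz ↦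
      hapex.not_compl_triangle (hout x hx) (hout y hy) (hout z hz)
  have hsub : {x, y, z} ⊆ Gᶜ.neighborFinset v := forall_mem_triple hx hy hz
  have h3 : (Gᶜ.neighborFinset v \ {x, y, z}).card = 3 := by
    rw [Finset.card_sdiff_of_subset hsub, hB,
      Finset.card_eq_three.2 ⟨x, y, z, hxy.ne, hxz.ne, hyz.ne, rfl⟩]
  obtain ⟨a, b, c, hab, hac, hbc, habc⟩ := Finset.card_eq_three.1 h3
  have htri : [x, y, z].Pairwise G.Adj := pairwise_adj_triple.2 ⟨hxy, hxz, hyz⟩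
  have hl : IsRestList G v ([x, y, z] ++ [a, b, c]) := by
    constructor
    · refine List.nodup_append.2 ⟨?_, ?_, fun u hu w hw huw ↦ ?_⟩
      · simp [hxy.ne, hxz.ne, hyz.ne]
      · simp [hab, hac, hbc]
      · have : w ∈ Gᶜ.neighborFinset v \ {x, y, z} := by rw [habc]; simpa using hw
        exact (Finset.mem_sdiff.1 this).2 (by rw [← huw]; simpa using hu)
    · intro w
      rw [← mem_neighborFinset, ← Finset.union_sdiff_of_subset hsub, habc]
      simp
      tauto
  obtain ⟨hs1, hs2⟩ := search_patterns hp
  have pacb : [a, c, b].Perm [a, b, c] := (List.Perm.swap b c []).cons a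
  have pbca : [b, c, a].Perm [a, b, c] :=
    ((List.Perm.swap a c []).cons b).trans (List.Perm.swap a b [c])
  exact hapex.not_pairwise_of_searchTriangles hcov hdeg hs2 hl htri (pairwise_adj_triple.2
    ⟨hapex.adj_of_searchNonadjacent hcov hdeg hs1 hl htri,
      hapex.adj_of_searchNonadjacent hcov hdeg hs1 (hl.perm (pacb.append_left _)) htri,
      hapex.adj_of_searchNonadjacent hcov hdeg hs1 (hl.perm (pbca.append_left _)) htri⟩)

/-- Every colouring of the complete graph on 14 vertices has a monochromatic image of the square of
the 8-cycle: otherwise all degrees in both colours are 6 or 7, and 7 occurs in one colour. -/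
theorem cayleyZ8_upper (R : SimpleGraph (Fin 14)) :
    Nonempty (cayleyZ8 →g R) ∨ Nonempty (cayleyZ8 →g Rᶜ) := by
  classical
  by_contra! h
  have hR := IsGood.of_isEmpty h.1 h.2
  have hsum : ∀ w, R.degree w + Rᶜ.degree w = 13 := fun w ↦ by
    have h1 := R.degree_compl (v := w)
    have h2 := hR.degree_le w
    rw [Fintype.card_fin] at h1
    omega
  have hdeg : ∀ w, R.degree w = 6 ∨ R.degree w = 7 := fun w ↦ by
    have h1 := hR.degree_le w
    have h2 := hR.compl.degree_le w
    have h3 := hsum w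
    omega
  have hdeg' : ∀ w, Rᶜ.degree w = 6 ∨ Rᶜ.degree w = 7 := fun w ↦ by
    have h1 := hdeg w
    have h3 := hsum w
    omega
  have h1 := hR.degree_ne_seven (by simp) hdeg 0
  have h2 := hR.compl.degree_ne_seven (by simp) hdeg' 0
  have h3 := hdeg 0
  have h4 := hdeg' 0
  have h5 := hsum 0
  omega

theorem chromaticRamseyNumber_cayleyZ8 : chromaticRamseyNumber cayleyZ8 = 14 :=
  chromaticRamseyNumber_eq cayleyZ8 13 cayleyZ8_upper _ cayleyZ8_lower.1 cayleyZ8_lower.2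

end ChromaticRamsey

theorem theorem5 :
    chromaticRamseyNumber cayleyZ8 = 14 ∧ chromaticRamseyNumber moserSpindle = 11 :=
  ⟨ChromaticRamsey.chromaticRamseyNumber_cayleyZ8,
    ChromaticRamsey.chromaticRamseyNumber_moserSpindle⟩
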